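/- **Setting.** Let $f,g\in\mathbb{Q}[x,y]$ be such that $\Sigma=\{f=0,\ g=0\}$ is zero-dimensional, i.e. has finitely many solutions in $\mathbb{C}^2$. After multiplying $f$ and $g$ by the least common denominators of their coefficients we get $F,G\in\mathbb{Z}[x,y]$ with the same zeros. Put $\deg_x=\max(\deg_xF,\deg_xG)$, $\deg_y=\max(\deg_yF,\deg_yG)$ and $N=\max(\|F\|_1,\|G\|_1)$, where $\|\cdot\|_1$ is the sum of the absolute values of the coefficients. *Projections.* Let $t\in\mathbb{Z}[x]$ be $\mathrm{Res}_y(F,G)$ without extraneous factors: if $\mathrm{Res}_y(F,G)$ is irreducible over $\mathbb{Q}$, then $t=\mathrm{Res}_y(F,G)$; otherwise $t$ is the product of the distinct (sign-normalized) irreducible factors $p\in\mathbb{Z}[x]$ of $\mathrm{Res}_y(F,G)$ for which some complex solution $(x_0,y_0)$ of $\Sigma$ satisfies $p(x_0)=0$. Let $T\in\mathbb{Z}[y]$ be obtained in the same way from $\mathrm{Res}_x(F,G)$. Let $u$ and $v$ be the numbers of distinct real roots of $t$ and of $T$. *Threshold.* Put $M=\max(\|t\|_1,\|T\|_1)$,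 $s=\deg t\cdot\deg T$, let $c$ be any real number with $c\ge \deg_x/\deg t+\deg_y/\deg T$ (a quotient with denominator $0$ is read as $0$), and $\varepsilon=N^{1-s}M^{-cs}$. For real $\alpha,\beta$ let $|\Sigma|(\alpha,\beta)$ be $\max(|F(\alpha,\beta)|,|G(\alpha,\beta)|)$ if $F(\alpha,\beta)=0$ or $G(\alpha,\beta)=0$, and $\min(|F(\alpha,\beta)|,|G(\alpha,\beta)|)$ otherwise. *Algorithm ZMM.* (i) Compute $t$, $T$ and $\varepsilon$. (ii) Isolate the real roots of $P=t$ and of $P=T$ by subdivision with Descartes' rule of signs: nothing is done if $P$ is constant; otherwise start with the interval $(-B,B)$, $B=1+\max_i|a_i|$, where the $a_i$ are the coefficients of $P$; for an interval $(a,b)$ let $w$ be the number of sign variations in the coefficients of $(1+z)^{\deg P}P\big(\frac{a+bz}{1+z}\big)$; discard $(a,b)$ if $w=0$, report it if $w=1$, and if $w\ge2$ bisect it, reporting the midpoint if it is a root and continuing with the two open halves. One step is the treatment of one interval. (iii) For all pairs of reported intervals, representing the real roots $\alpha_i$ of $t$ and $\beta_j$ of $T$, test whether $|\Sigma|(\alpha_i,\beta_j)<\varepsilon$,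 and output the pairs that pass. One step is the test of one pair; the values at the exact real roots are used. **Theorem.** There is an absolute constant $K>0$ such that for all such $f,g$ and $c$ Algorithm ZMM terminates, and: 1. (Correctness) The intervals reported for $t$ and for $T$ isolate their real roots, the set of the output points $(\alpha_i,\beta_j)$ is exactly the set of real solutions of $\Sigma$, and the corresponding boxes (products of the reported intervals or points) isolate these solutions: each box contains exactly one real solution, and each real solution lies in exactly one box. 2. (Univariate solving) For $P=t$ and for $P=T$ the number of steps of the isolation is at most $K(d\tau+d\lg d)$, where $d=\deg P$, $\tau=1+\max_{a_i\ne0}\lg|a_i|$, $\lg=\log_2$, and $d\lg d=0$ for $d=0$. 3. (Matching) The number of steps of the matching is at most $K\,uv$. -/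

import Mathlib

open Polynomial
open scoped Polynomial.Bivariate

namespace ZMM

noncomputable section

/-! Bivariate polynomials are elements of `R[X][Y]`: the inner variable is `x`, the outer one `y`.
`aevalAeval x y f` is the value `f(x, y)`. -/

/-- The system `f = g = 0` has finitely many complex solutions. -/
def ZeroDimensional (f g : ℚ[X][Y]) : Prop :=
  {p : ℂ × ℂ | aevalAeval p.1 p.2 f = 0 ∧ aevalAeval p.1 p.2 g = 0}.Finite

/-- The set of real solutions of `f = g = 0`. -/
def realSolutions (f g : ℚ[X][Y]) : Set (ℝ × ℝ) :=
  {p : ℝ × ℝ | aevalAeval p.1 p.2 f = 0 ∧ aevalAeval p.1 p.2 g = 0}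

/-! ### Clearing denominators -/

/-- The least common multiple of the denominators of the coefficients of `f`. -/
def commonDen (f : ℚ[X][Y]) : ℕ :=
  f.support.lcm fun j => (f.coeff j).support.lcm fun i => ((f.coeff j).coeff i).den

/-- The integer polynomial `commonDen f • f`. -/
def clearDen (f : ℚ[X][Y]) : ℤ[X][Y] :=
  ∑ j ∈ f.support, monomial j
    (∑ i ∈ (f.coeff j).support, monomial i ((f.coeff j).coeff i * (commonDen f : ℚ)).num)

/-! ### Sizes of polynomials -/

/-- The one norm of a univariate integer polynomial. -/
def norm1 (P : ℤ[X]) : ℕ := ∑ i ∈ P.support, (P.coeff i).natAbs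

/-- The one norm of a bivariate integer polynomial. -/
def biNorm1 (F : ℤ[X][Y]) : ℕ := ∑ j ∈ F.support, norm1 (F.coeff j)

/-- The largest absolute value of a coefficient. -/
def height (P : ℤ[X]) : ℕ := P.support.sup fun i => (P.coeff i).natAbs

/-- `τ = 1 + max lg |a_i|`, the maximum being over the nonzero coefficients. -/
def bitsize (P : ℤ[X]) : ℝ := 1 + Real.logb 2 (height P)

/-- `d τ + d lg d`. -/
def solveBound (P : ℤ[X]) : ℝ :=
  P.natDegree * bitsize P + P.natDegree * Real.logb 2 P.natDegree

/-! ### Resultants without extraneous factors -/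

/-- A factor `p` of the resultant in `x` is extraneous when no complex solution of the system has
a root of `p` as its `x`-coordinate. -/
def Extraneous (F G : ℤ[X][Y]) (p : ℤ[X]) : Prop :=
  ¬ ∃ x y : ℂ, aevalAeval x y F = 0 ∧ aevalAeval x y G = 0 ∧ aeval x p = 0

open scoped Classical in
/-- The resultant with respect to `y`, returned unchanged when it is irreducible over `ℚ`.
Otherwise the extraneous irreducible factors (these include the constant ones) and the repetitions
of the other irreducible factors are discarded. -/
def noExtrRes (F G : ℤ[X][Y]) : ℤ[X] :=
  if Irreducible ((resultant F G).map (Int.castRingHom ℚ)) then resultant F G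
  else ∏ p ∈ (UniqueFactorizationMonoid.normalizedFactors (resultant F G)).toFinset.filter
    (fun p => ¬ Extraneous F G p), p

/-- The projection on the `x`-axis, `Res_y(F, G)` without extraneous factors. -/
def resX (F G : ℤ[X][Y]) : ℤ[X] := noExtrRes F G

/-- The projection on the `y`-axis, `Res_x(F, G)` without extraneous factors. -/
def resY (F G : ℤ[X][Y]) : ℤ[X] := noExtrRes (Bivariate.swap F) (Bivariate.swap G)

/-! ### The threshold -/

/-- The larger of the degrees of `F` and `G` in `x`. -/
def degX (F G : ℤ[X][Y]) : ℕ :=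
  max (Bivariate.swap F).natDegree (Bivariate.swap G).natDegree

/-- The larger of the degrees of `F` and `G` in `y`. -/
def degY (F G : ℤ[X][Y]) : ℕ := max F.natDegree G.natDegree

/-- `N`, the larger of the one norms of `F` and `G`. -/
def normN (F G : ℤ[X][Y]) : ℕ := max (biNorm1 F) (biNorm1 G)

/-- `M`, the larger of the one norms of the two projections. -/
def normM (F G : ℤ[X][Y]) : ℕ := max (norm1 (resX F G)) (norm1 (resY F G))

/-- `s`, the product of the degrees of the two projections. -/
def paramS (F G : ℤ[X][Y]) : ℕ := (resX F G).natDegree * (resY F G).natDegree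

/-- The condition on the constant `c` in the exponent of the threshold:
`deg_x / deg t + deg_y / deg T ≤ c`. -/
def Admissible (F G : ℤ[X][Y]) (c : ℝ) : Prop :=
  (degX F G : ℝ) / (resX F G).natDegree + (degY F G : ℝ) / (resY F G).natDegree ≤ c

/-- The threshold `ε = N ^ (1 - s) * M ^ (-c s)`. -/
def eps (F G : ℤ[X][Y]) (c : ℝ) : ℝ :=
  (normN F G : ℝ) ^ (1 - (paramS F G : ℤ)) * (normM F G : ℝ) ^ (-(c * paramS F G))

/-- The value `|Σ|` at `(a, b)`: the maximum of `|F(a, b)|` and `|G(a, b)|` if one of them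
vanishes, their minimum otherwise. -/
def sigmaAbs (F G : ℤ[X][Y]) (a b : ℝ) : ℝ :=
  if aevalAeval a b F = 0 ∨ aevalAeval a b G = 0 then
    max |aevalAeval a b F| |aevalAeval a b G|
  else min |aevalAeval a b F| |aevalAeval a b G|

/-! ### Real root isolation by subdivision and Descartes' rule of signs -/

/-- A pair `(a, b)` with `a < b` stands for the open interval, a pair `(a, a)` for the point. -/
def InIv (I : ℚ × ℚ) (x : ℝ) : Prop :=
  ((I.1 : ℝ) < x ∧ x < I.2) ∨ ((I.1 : ℝ) = x ∧ x = I.2)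

/-- `(1 + z) ^ d * P((a + b z) / (1 + z))` with `d = deg P`: its positive roots correspond to the
roots of `P` in the open interval `(a, b)`. -/
def moebius (P : ℤ[X]) (a b : ℚ) : ℚ[X] :=
  ∑ i ∈ Finset.range (P.natDegree + 1),
    C (P.coeff i : ℚ) * (C a + C b * X) ^ i * (1 + X) ^ (P.natDegree - i)

/-- The number of sign variations attached to `P` and the interval `(a, b)`. -/
def descartesVar (P : ℤ[X]) (a b : ℚ) : ℕ := (moebius P a b).signVariations

/-- `Subdivide P a b L n`: the subdivision procedure started on the open interval `(a, b)`
terminates with the list `L` of intervals after `n` steps. A step treats one interval: it is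
discarded (no sign variation), reported (one variation), or bisected (two or more); on bisection
the midpoint is reported if it is a root. -/
inductive Subdivide (P : ℤ[X]) : ℚ → ℚ → List (ℚ × ℚ) → ℕ → Prop
  | discard (a b : ℚ) (h : descartesVar P a b = 0) : Subdivide P a b [] 1
  | report (a b : ℚ) (h : descartesVar P a b = 1) : Subdivide P a b [(a, b)] 1
  | bisect (a b : ℚ) (L₁ L₂ : List (ℚ × ℚ)) (n₁ n₂ : ℕ) (h : 2 ≤ descartesVar P a b)
      (left : Subdivide P a ((a + b) / 2) L₁ n₁) (right : Subdivide P ((a + b) / 2) b L₂ n₂) :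
      Subdivide P a b
        (L₁ ++ (if aeval ((a + b) / 2) P = 0 then [((a + b) / 2, (a + b) / 2)] else []) ++ L₂)
        (n₁ + n₂ + 1)

/-- `Isolate P L n`: isolating the real roots of `P` gives the list `L` in `n` steps. Nothing is
done for a constant; otherwise the subdivision starts on `(-B, B)` with Cauchy's root bound
`B = 1 + max |a_i|`. -/
inductive Isolate (P : ℤ[X]) : List (ℚ × ℚ) → ℕ → Prop
  | const (h : P.natDegree = 0) : Isolate P [] 0
  | run (L : List (ℚ × ℚ)) (n : ℕ) (h : P.natDegree ≠ 0)
      (hrun : Subdivide P (-(1 + height P : ℚ)) (1 + height P : ℚ) L n) : Isolate P L n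

/-- `L` isolates the real roots of `P`: every listed interval contains exactly one real root, and
every real root lies in exactly one listed interval, listed once. -/
def IsIsolation (P : ℤ[X]) (L : List (ℚ × ℚ)) : Prop :=
  L.Nodup ∧ (∀ I ∈ L, ∃! x : ℝ, InIv I x ∧ aeval x P = 0) ∧
    ∀ x : ℝ, aeval x P = 0 → ∃! I, I ∈ L ∧ InIv I x

/-- The real root of `P` that is represented by an isolating interval `I`. -/
def isoRoot (P : ℤ[X]) (I : ℚ × ℚ) : ℝ :=
  Classical.epsilon fun x : ℝ => InIv I x ∧ aeval x P = 0

/-! ### Matching -/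

/-- The inner loop of the matching: the accepted pairs `(a, b)`, and the number of pairs tested. -/
def matchRow {A B : Type} (test : A → B → Bool) (a : A) : List B → List (A × B) × ℕ
  | [] => ([], 0)
  | b :: bs =>
      let r := matchRow test a bs
      (if test a b then (a, b) :: r.1 else r.1, r.2 + 1)

/-- The outer loop of the matching: the accepted pairs, and the number of pairs tested. -/
def matchAll {A B : Type} (test : A → B → Bool) : List A → List B → List (A × B) × ℕ
  | [], _ => ([], 0)
  | a :: as, bs =>
      let r := matchRow test a bs
      let q := matchAll test as bs
      (r.1 ++ q.1, r.2 + q.2)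

/-- The test `|Σ| < ε` at the real roots of the two projections represented by `I` and `J`. -/
def pairTest (F G : ℤ[X][Y]) (c : ℝ) (I J : ℚ × ℚ) : Bool :=
  decide (sigmaAbs F G (isoRoot (resX F G) I) (isoRoot (resY F G) J) < eps F G c)

/-! ### The algorithm -/

/-- The data produced by a run: isolating intervals of the real roots of the two projections with
the numbers of subdivision steps, and the matched pairs with the number of pairs tested. -/
structure Result where
  intervalsX : List (ℚ × ℚ)
  stepsX : ℕ
  intervalsY : List (ℚ × ℚ)
  stepsY : ℕ
  boxes : List ((ℚ × ℚ) × (ℚ × ℚ))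
  matchSteps : ℕ

/-- `RunInt F G c r`: the algorithm on integer polynomials terminates with result `r`. -/
def RunInt (F G : ℤ[X][Y]) (c : ℝ) (r : Result) : Prop :=
  Isolate (resX F G) r.intervalsX r.stepsX ∧
  Isolate (resY F G) r.intervalsY r.stepsY ∧
  (r.boxes, r.matchSteps) = matchAll (pairTest F G c) r.intervalsX r.intervalsY

/-- `Run f g c r`: the algorithm on rational polynomials terminates with result `r`. It first
clears the denominators. -/
def Run (f g : ℚ[X][Y]) (c : ℝ) (r : Result) : Prop :=
  RunInt (clearDen f) (clearDen g) c r

/-- The set of points represented by the matched pairs of intervals. -/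
def solutionSet (F G : ℤ[X][Y]) (r : Result) : Set (ℝ × ℝ) :=
  {p | ∃ B ∈ r.boxes, p = (isoRoot (resX F G) B.1, isoRoot (resY F G) B.2)}

/-- The boxes isolate the real solutions of `f = g = 0`: every listed box contains exactly one
real solution, and every real solution lies in exactly one listed box, listed once. -/
def IsolatesSolutions (f g : ℚ[X][Y]) (L : List ((ℚ × ℚ) × (ℚ × ℚ))) : Prop :=
  L.Nodup ∧
  (∀ B ∈ L, ∃! p : ℝ × ℝ, (InIv B.1 p.1 ∧ InIv B.2 p.2) ∧ p ∈ realSolutions f g) ∧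
  ∀ p ∈ realSolutions f g, ∃! B, B ∈ L ∧ InIv B.1 p.1 ∧ InIv B.2 p.2

end

end ZMM

/-! If the Möbius transform of an interval `(a, b)` has at least two sign variations, then `P` has
two complex roots within `b - a` of the midpoint: a product of linear and quadratic factors whose
roots are farther away transforms into a polynomial with log-concave coefficients, and one more
linear factor adds at most one variation to these. Every bisected interval at depth `h` is therefore
charged to a root whose separation is at most of order `2 ^ (-h)`. The product of the separations
is bounded below because the resultant of `P` and `P'` is a nonzero integer, and this bounds the
size of the whole subdivision tree by a multiple of `d τ + d lg d`.

For the matching, `Res_x(t, Res_y(T, z - F))` is an integer polynomial in `z` whose roots are the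
values of `F` at the pairs of roots of `t` and `T`. Up to sign its lowest nonzero coefficient, an
integer, is the product of its nonzero roots and its leading coefficient, so bounding the other
values from above bounds a nonzero value from below, and `ε` is at most this bound. -/

namespace ZMM

/-! ### Sign variations -/

theorem coeffList_map_of_injective {R S : Type*} [Semiring R] [Semiring S] {f : R →+* S}
    (hf : Function.Injective f) (p : R[X]) : (p.map f).coeffList = p.coeffList.map f := by
  simp [coeffList, degree_map_eq_of_injective hf, Function.comp_def]

theorem signVariations_map_of_strictMono {R S : Type*} [Semiring R] [LinearOrder R] [Semiring S]
    [LinearOrder S] {f : R →+* S} (hf : StrictMono f) (p : R[X]) :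
    (p.map f).signVariations = p.signVariations := by
  have hsign : SignType.sign ∘ f = (SignType.sign : R → SignType) := funext hf.sign_comp
  rw [signVariations, signVariations, coeffList_map_of_injective hf.injective, List.map_map, hsign]

theorem sign_ne_neg_sign {α : Type*} [Zero α] [LinearOrder α] {x y : α} (hx : 0 < x)
    (hy : 0 ≤ y) : SignType.sign x ≠ -SignType.sign y := by
  rw [sign_pos hx]
  rcases hy.eq_or_lt with rfl | hy
  · simp
  · rw [sign_pos hy]; decide

theorem signVariations_eq_zero_of_nonneg {R : Type*} [Semiring R] [LinearOrder R] (P : R[X])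
    (h : ∀ i, 0 ≤ P.coeff i) : P.signVariations = 0 := by
  rcases eq_or_ne P 0 with rfl | hP
  · exact signVariations_zero R
  have hE : ∀ i, 0 ≤ P.eraseLead.coeff i := fun i => by
    rw [eraseLead_coeff]; split_ifs <;> simp [h]
  have hlead : 0 < P.leadingCoeff := (h _).lt_of_ne' (leadingCoeff_ne_zero.mpr hP)
  have hE0 : 0 ≤ P.eraseLead.leadingCoeff := hE _
  rw [signVariations_eq_eraseLead_add_ite hP, signVariations_eq_zero_of_nonneg _ hE,
    if_neg (sign_ne_neg_sign hlead hE0), add_zero]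
termination_by P.support.card
decreasing_by exact eraseLead_support_card_lt hP

theorem trailingCoeff_eraseLead {R : Type*} [Semiring R] {P : R[X]} (h : P.eraseLead ≠ 0) :
    P.eraseLead.trailingCoeff = P.trailingCoeff := by
  have hP : P ≠ 0 := by rintro rfl; simp at h
  have hlt : P.natTrailingDegree < P.natDegree := by
    obtain ⟨i, hi⟩ := nonempty_support_iff.mpr h
    refine lt_of_le_of_lt (natTrailingDegree_le_of_mem_supp i ?_)
      (lt_natDegree_of_mem_eraseLead_support hi)
    rw [eraseLead_support] at hi
    exact Finset.mem_of_mem_erase hi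
  have hcoeff : P.eraseLead.coeff P.natTrailingDegree = P.trailingCoeff :=
    eraseLead_coeff_of_ne _ hlt.ne
  have hdeg : P.eraseLead.natTrailingDegree = P.natTrailingDegree := by
    refine le_antisymm (natTrailingDegree_le_of_ne_zero ?_) (le_natTrailingDegree h fun m hm => ?_)
    · rw [hcoeff]; exact mt trailingCoeff_eq_zero.mp hP
    · rw [eraseLead_coeff, coeff_eq_zero_of_lt_natTrailingDegree hm, ite_self]
  rw [trailingCoeff, hdeg, hcoeff]

section Ring

variable {R : Type*} [Ring R] [LinearOrder R] [IsOrderedRing R]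

theorem signVariations_eq_zero_of_nonpos {P : R[X]} (h : ∀ i, P.coeff i ≤ 0) :
    P.signVariations = 0 := by
  rw [← signVariations_neg]
  exact signVariations_eq_zero_of_nonneg _ fun i => by simpa using h i

theorem signVariations_eq_zero_of_leadingCoeff_neg {P : R[X]}
    (h : ∀ i j, i ≤ j → 0 ≤ P.coeff i → 0 ≤ P.coeff j) (hlead : P.leadingCoeff < 0) :
    P.signVariations = 0 := by
  refine signVariations_eq_zero_of_nonpos fun i => ?_
  rcases lt_or_ge P.natDegree i with hi | hi
  · rw [coeff_eq_zero_of_natDegree_lt hi]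
  · exact (lt_of_not_ge fun hc => (h i _ hi hc).not_gt hlead).le

theorem signVariations_le_one_of_nonneg_of_le (P : R[X])
    (h : ∀ i j, i ≤ j → 0 ≤ P.coeff i → 0 ≤ P.coeff j) : P.signVariations ≤ 1 := by
  rcases eq_or_ne P 0 with rfl | hP
  · simp
  rcases lt_or_gt_of_ne (leadingCoeff_ne_zero.mpr hP) with hlead | hlead
  · simp [signVariations_eq_zero_of_leadingCoeff_neg h hlead]
  have hE : ∀ i j, i ≤ j → 0 ≤ P.eraseLead.coeff i → 0 ≤ P.eraseLead.coeff j := by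
    intro i j hij hi
    rw [eraseLead_coeff] at hi ⊢
    split_ifs with hj
    · rfl
    · split_ifs at hi with hi'
      · exact h i j hij (by rw [hi']; exact hlead.le)
      · exact h i j hij hi
  rcases lt_or_ge P.eraseLead.leadingCoeff 0 with hE0 | hE0
  · rw [signVariations_eq_eraseLead_add_ite hP,
      signVariations_eq_zero_of_leadingCoeff_neg hE hE0]
    split_ifs <;> simp
  · rw [signVariations_eq_eraseLead_add_ite hP, if_neg (sign_ne_neg_sign hlead hE0), add_zero]
    exact signVariations_le_one_of_nonneg_of_le _ hE
termination_by P.support.card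
decreasing_by exact eraseLead_support_card_lt hP

end Ring

theorem sign_leadingCoeff_eq_neg_one_pow_signVariations_mul {R : Type*} [Semiring R]
    [LinearOrder R] (P : R[X]) :
    SignType.sign P.leadingCoeff = (-1) ^ P.signVariations * SignType.sign P.trailingCoeff := by
  rcases eq_or_ne P 0 with rfl | hP
  · simp
  by_cases hE : P.eraseLead = 0
  · have hmonomial : P = monomial P.natDegree P.leadingCoeff := by
      conv_lhs => rw [← eraseLead_add_monomial_natDegree_leadingCoeff P, hE, zero_add]
    have htrail : P.trailingCoeff = P.leadingCoeff := by
      conv_lhs => rw [hmonomial]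
      rw [trailingCoeff, natTrailingDegree_monomial (leadingCoeff_ne_zero.mpr hP)]
      simp
    simp [signVariations_eq_eraseLead_add_ite hP, hE, htrail, hP]
  · have ih := sign_leadingCoeff_eq_neg_one_pow_signVariations_mul P.eraseLead
    rw [trailingCoeff_eraseLead hE] at ih
    rw [signVariations_eq_eraseLead_add_ite hP]
    split_ifs with hs
    · rw [hs, ih, pow_succ]; simp
    · have h1 : SignType.sign P.leadingCoeff ≠ 0 := by simpa using hP
      have h2 : SignType.sign P.eraseLead.leadingCoeff ≠ 0 := by simpa using hE
      rw [add_zero, ← ih]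
      generalize SignType.sign P.leadingCoeff = x at h1 hs ⊢
      generalize SignType.sign P.eraseLead.leadingCoeff = y at h2 hs ⊢
      decide +revert
termination_by P.support.card
decreasing_by exact eraseLead_support_card_lt hP

theorem exists_pos_root_of_eval_zero_neg {Q : ℝ[X]} (h0 : Q.eval 0 < 0)
    (hlead : 0 < Q.leadingCoeff) : ∃ x, 0 < x ∧ Q.eval x = 0 := by
  have hdeg : 0 < Q.degree := by
    refine lt_of_not_ge fun hd => ?_
    rw [eq_C_of_degree_le_zero hd] at h0 hlead
    simp only [eval_C, leadingCoeff_C] at h0 hlead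
    exact h0.not_gt hlead
  obtain ⟨y, hQy, hy⟩ := ((Q.tendsto_atTop_of_leadingCoeff_nonneg hdeg hlead.le
    |>.eventually_ge_atTop 0).and (Filter.eventually_gt_atTop 0)).exists
  obtain ⟨x, hx, hQx⟩ := intermediate_value_Icc hy.le Q.continuous.continuousOn ⟨h0.le, hQy⟩
  exact ⟨x, hx.1.lt_of_ne (by rintro rfl; exact h0.ne hQx), hQx⟩

theorem exists_pos_root_of_signVariations_eq_one {P : ℝ[X]} (h : P.signVariations = 1) :
    ∃ x, 0 < x ∧ P.eval x = 0 := by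
  have hP : P ≠ 0 := by rintro rfl; simp at h
  wlog hlead : 0 < P.leadingCoeff generalizing P
  · obtain ⟨x, hx, hx'⟩ := this (P := -P) (by simpa using h) (neg_ne_zero.mpr hP) (by
      simpa using (not_lt.mp hlead).lt_of_ne (leadingCoeff_ne_zero.mpr hP))
    exact ⟨x, hx, by simpa using hx'⟩
  have htrail : P.trailingCoeff < 0 := by
    have hs := sign_leadingCoeff_eq_neg_one_pow_signVariations_mul P
    rw [h, sign_pos hlead, pow_one] at hs
    exact sign_eq_neg_one_iff.mp (by rw [← neg_inj, neg_neg, hs, neg_one_mul])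
  obtain ⟨Q, hQ⟩ : X ^ P.natTrailingDegree ∣ P :=
    X_pow_dvd_iff.mpr fun d hd => coeff_eq_zero_of_lt_natTrailingDegree hd
  have hQ0 : Q.eval 0 = P.trailingCoeff := by
    rw [← coeff_zero_eq_eval_zero, ← coeff_X_pow_mul Q P.natTrailingDegree, ← hQ, zero_add,
      trailingCoeff]
  have hQlead : Q.leadingCoeff = P.leadingCoeff := by
    rw [← leadingCoeff_monic_mul (monic_X_pow P.natTrailingDegree), ← hQ]
  obtain ⟨x, hx, hQx⟩ := exists_pos_root_of_eval_zero_neg (hQ0 ▸ htrail) (hQlead ▸ hlead)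
  exact ⟨x, hx, by rw [hQ, eval_mul, hQx, mul_zero]⟩

/-! ### Möbius transforms and log-concavity -/

section MoebiusTransform

variable {K : Type*} [Field K]

/-- `(1 + z) ^ n * p((a + b z) / (1 + z))` for a polynomial `p` of degree at most `n`; `moebius`
is the case `n = deg p` over the rationals. -/
noncomputable def moebiusTransform (n : ℕ) (p : K[X]) (a b : K) : K[X] :=
  ∑ i ∈ Finset.range (n + 1), C (p.coeff i) * (C a + C b * X) ^ i * (1 + X) ^ (n - i)

theorem map_moebius [CharZero K] (P : ℤ[X]) (a b : ℚ) :
    (moebius P a b).map (algebraMap ℚ K) =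
      moebiusTransform P.natDegree (P.map (algebraMap ℤ K)) a b := by
  simp [moebius, moebiusTransform, Polynomial.map_sum]

theorem moebiusTransform_C (c a b : K) : moebiusTransform 0 (C c) a b = C c := by
  simp [moebiusTransform]

theorem eval_moebiusTransform {n : ℕ} {p : K[X]} (hp : p.natDegree ≤ n) (a b : K) {z : K}
    (hz : 1 + z ≠ 0) :
    (moebiusTransform n p a b).eval z = (1 + z) ^ n * p.eval ((a + b * z) / (1 + z)) := by
  rw [eval_eq_sum_range' (Nat.lt_succ_of_le hp), moebiusTransform, eval_finsetSum, Finset.mul_sum]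
  refine Finset.sum_congr rfl fun i hi => ?_
  obtain ⟨k, rfl⟩ := Nat.exists_eq_add_of_le (Finset.mem_range_succ_iff.mp hi)
  simp only [eval_mul, eval_C, eval_pow, eval_add, eval_X, eval_one, div_pow, pow_add,
    Nat.add_sub_cancel_left]
  field_simp

variable [Infinite K]

theorem eq_of_forall_ne_eval_eq (x : K) {p q : K[X]} (h : ∀ z, z ≠ x → p.eval z = q.eval z) :
    p = q :=
  eq_of_infinite_eval_eq p q ((Set.finite_singleton x).infinite_compl.mono fun z hz => h z hz)

theorem moebiusTransform_mul {m n : ℕ} {p q : K[X]} (hp : p.natDegree ≤ m)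
    (hq : q.natDegree ≤ n) (a b : K) :
    moebiusTransform (m + n) (p * q) a b =
      moebiusTransform m p a b * moebiusTransform n q a b := by
  refine eq_of_forall_ne_eval_eq (-1) fun z hz => ?_
  have hz' : 1 + z ≠ 0 := fun h => hz (by linear_combination h)
  rw [eval_mul, eval_moebiusTransform hp _ _ hz', eval_moebiusTransform hq _ _ hz',
    eval_moebiusTransform (natDegree_mul_le.trans (add_le_add hp hq)) _ _ hz', eval_mul, pow_add]
  ring

theorem moebiusTransform_X_sub_C (r a b : K) :
    moebiusTransform 1 (X - C r) a b = C (b - r) * X + C (a - r) := by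
  refine eq_of_forall_ne_eval_eq (-1) fun z hz => ?_
  have hz' : 1 + z ≠ 0 := fun h => hz (by linear_combination h)
  rw [eval_moebiusTransform (natDegree_X_sub_C_le r) _ _ hz']
  simp only [eval_sub, eval_add, eval_mul, eval_X, eval_C]
  field_simp
  ring

theorem moebiusTransform_quadratic (u v a b : K) :
    moebiusTransform 2 (X ^ 2 - C u * X + C v) a b =
      C (b ^ 2 - u * b + v) * X ^ 2 + C (2 * a * b - u * (a + b) + 2 * v) * X
        + C (a ^ 2 - u * a + v) := by
  refine eq_of_forall_ne_eval_eq (-1) fun z hz => ?_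
  have hz' : 1 + z ≠ 0 := fun h => hz (by linear_combination h)
  rw [eval_moebiusTransform (by compute_degree) _ _ hz']
  simp only [eval_sub, eval_add, eval_mul, eval_pow, eval_X, eval_C]
  field_simp
  ring

end MoebiusTransform

section LogConcave

variable {R : Type*} [CommRing R] [LinearOrder R] {p : R[X]}

/-- Polynomials with log-concave coefficients without internal zeros: the coefficients are positive
up to some index and vanish beyond it. -/
structure LogConcave (p : R[X]) : Prop where
  nonneg : ∀ i, 0 ≤ p.coeff i
  pos : 0 < p.coeff 0
  zero_succ : ∀ i, p.coeff i = 0 → p.coeff (i + 1) = 0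
  concave : ∀ i, p.coeff i * p.coeff (i + 2) ≤ p.coeff (i + 1) ^ 2

theorem logConcave_C {c : R} (hc : 0 < c) : LogConcave (C c) where
  nonneg i := by rw [coeff_C]; split_ifs <;> simp [hc.le]
  pos := by simpa
  zero_succ i _ := by simp
  concave i := by simp

variable [IsStrictOrderedRing R]

theorem LogConcave.mul_le (h : LogConcave p) (i k : ℕ) :
    p.coeff i * p.coeff (i + k + 2) ≤ p.coeff (i + 1) * p.coeff (i + k + 1) := by
  induction k with
  | zero => simpa [sq] using h.concave i
  | succ k ih =>
    change p.coeff i * p.coeff (i + k + 3) ≤ p.coeff (i + 1) * p.coeff (i + k + 2)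
    have h0 := h.nonneg i
    have h2 := h.nonneg (i + k + 2)
    rcases (h.nonneg (i + k + 1)).eq_or_lt with h1 | h1
    · rw [h.zero_succ _ (h.zero_succ _ h1.symm), mul_zero]
      exact mul_nonneg (h.nonneg _) h2
    · refine le_of_mul_le_mul_right ?_ h1
      calc p.coeff i * p.coeff (i + k + 3) * p.coeff (i + k + 1)
          = p.coeff i * (p.coeff (i + k + 1) * p.coeff (i + k + 3)) := by ring
        _ ≤ p.coeff i * p.coeff (i + k + 2) ^ 2 := by gcongr; exact h.concave (i + k + 1)
        _ = p.coeff i * p.coeff (i + k + 2) * p.coeff (i + k + 2) := by ring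
        _ ≤ p.coeff (i + 1) * p.coeff (i + k + 1) * p.coeff (i + k + 2) := by gcongr
        _ = p.coeff (i + 1) * p.coeff (i + k + 2) * p.coeff (i + k + 1) := by ring

theorem concave_combination {e x y z w A B D : R} (hA : 0 ≤ A) (hB : 0 ≤ B) (hD : 0 ≤ D)
    (hAD : A * D ≤ B ^ 2) (h1 : e * y ≤ x ^ 2) (h2 : e * z ≤ x * y) (h3 : x * z ≤ y ^ 2)
    (h4 : e * w ≤ x * z) (h5 : x * w ≤ y * z) (h6 : y * w ≤ z ^ 2) :
    (A * e + B * x + D * y) * (A * y + B * z + D * w) ≤ (A * x + B * y + D * z) ^ 2 := by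
  have t1 := mul_nonneg (mul_nonneg hA hA) (sub_nonneg.mpr h1)
  have t2 := mul_nonneg (mul_nonneg hA hB) (sub_nonneg.mpr h2)
  have t3 := mul_nonneg (sub_nonneg.mpr hAD) (sub_nonneg.mpr h3)
  have t4 := mul_nonneg (mul_nonneg hA hD) (sub_nonneg.mpr h4)
  have t5 := mul_nonneg (mul_nonneg hB hD) (sub_nonneg.mpr h5)
  have t6 := mul_nonneg (mul_nonneg hD hD) (sub_nonneg.mpr h6)
  linear_combination t1 + t2 + t3 + t4 + t5 + t6

theorem coeff_linear_mul_zero {S : Type*} [CommRing S] (u v : S) (p : S[X]) :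
    ((C v * X + C u) * p).coeff 0 = u * p.coeff 0 := by
  simp [mul_coeff_zero]

theorem coeff_linear_mul_succ {S : Type*} [CommRing S] (u v : S) (p : S[X]) (k : ℕ) :
    ((C v * X + C u) * p).coeff (k + 1) = v * p.coeff k + u * p.coeff (k + 1) := by
  rw [add_mul, mul_assoc, coeff_add, coeff_C_mul, coeff_X_mul, coeff_C_mul]

theorem coeff_quadratic_mul_zero {S : Type*} [CommRing S] (A B D : S) (p : S[X]) :
    ((C A * X ^ 2 + C B * X + C D) * p).coeff 0 = D * p.coeff 0 := by
  simp [mul_coeff_zero]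

theorem coeff_quadratic_mul_one {S : Type*} [CommRing S] (A B D : S) (p : S[X]) :
    ((C A * X ^ 2 + C B * X + C D) * p).coeff 1 = B * p.coeff 0 + D * p.coeff 1 := by
  rw [show (C A * X ^ 2 + C B * X + C D) * p = (C (0 : S) * X + C A) * (X * (X * p)) +
    (C B * X + C D) * p by simp only [C_0]; ring, coeff_add, coeff_linear_mul_succ,
    coeff_linear_mul_succ]
  simp [mul_coeff_zero]

theorem coeff_quadratic_mul_add_two {S : Type*} [CommRing S] (A B D : S) (p : S[X]) (k : ℕ) :
    ((C A * X ^ 2 + C B * X + C D) * p).coeff (k + 2) =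
      A * p.coeff k + B * p.coeff (k + 1) + D * p.coeff (k + 2) := by
  rw [show (C A * X ^ 2 + C B * X + C D) * p =
    C A * (X * (X * p)) + C B * (X * p) + C D * p by ring]
  simp only [coeff_add, coeff_C_mul, coeff_X_mul]

theorem LogConcave.concave_quadratic_mul (h : LogConcave p) {A B D : R} (hA : 0 ≤ A) (hB : 0 ≤ B)
    (hD : 0 ≤ D) (hAD : A * D ≤ B ^ 2) (i : ℕ) :
    ((C A * X ^ 2 + C B * X + C D) * p).coeff i *
        ((C A * X ^ 2 + C B * X + C D) * p).coeff (i + 2) ≤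
      ((C A * X ^ 2 + C B * X + C D) * p).coeff (i + 1) ^ 2 := by
  have h0 := h.nonneg 0
  have h1 := h.nonneg 1
  obtain _ | _ | i := i
  · rw [zero_add, zero_add, coeff_quadratic_mul_zero, coeff_quadratic_mul_one,
      coeff_quadratic_mul_add_two]
    simpa using concave_combination (e := 0) (x := 0) hA hB hD hAD (by simp) (by simp)
      (by simpa using sq_nonneg (p.coeff 0)) (by simp) (by simpa using mul_nonneg h0 h1)
      (h.concave 0)
  · rw [zero_add, coeff_quadratic_mul_one, coeff_quadratic_mul_add_two,
      coeff_quadratic_mul_add_two]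
    simpa using concave_combination (e := 0) hA hB hD hAD
      (by simpa using sq_nonneg (p.coeff 0)) (by simpa using mul_nonneg h0 h1)
      (h.concave 0) (by simpa using mul_nonneg h0 (h.nonneg 2)) (h.mul_le 0 1) (h.concave 1)
  · rw [coeff_quadratic_mul_add_two, coeff_quadratic_mul_add_two,
      show i + 1 + 1 + 1 = i + 1 + 2 by ring, coeff_quadratic_mul_add_two]
    exact concave_combination hA hB hD hAD (h.concave i) (h.mul_le i 1) (h.concave _)
      (h.mul_le i 2) (h.mul_le (i + 1) 1) (h.concave _)

theorem LogConcave.quadratic_mul (h : LogConcave p) {A B D : R} (hA : 0 ≤ A) (hB : 0 < B)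
    (hD : 0 < D) (hAD : A * D ≤ B ^ 2) : LogConcave ((C A * X ^ 2 + C B * X + C D) * p) := by
  have h0 := h.nonneg 0
  have h1 := h.nonneg 1
  refine ⟨?nonneg, ?pos, ?zero_succ, ?concave⟩
  case nonneg =>
    rintro (_ | _ | i)
    · rw [coeff_quadratic_mul_zero]; positivity
    · rw [coeff_quadratic_mul_one]; positivity
    · rw [coeff_quadratic_mul_add_two]
      have := h.nonneg i; have := h.nonneg (i + 1); have := h.nonneg (i + 2); positivity
  case pos => rw [coeff_quadratic_mul_zero]; exact mul_pos hD h.pos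
  case zero_succ =>
    rintro (_ | _ | i) hi
    · rw [coeff_quadratic_mul_zero] at hi
      exact absurd hi (mul_pos hD h.pos).ne'
    · rw [zero_add, coeff_quadratic_mul_one] at hi
      exact absurd hi (add_pos_of_pos_of_nonneg (mul_pos hB h.pos) (mul_nonneg hD.le h1)).ne'
    · rw [coeff_quadratic_mul_add_two] at hi
      have hA' := mul_nonneg hA (h.nonneg i)
      have hB' := mul_nonneg hB.le (h.nonneg (i + 1))
      have hD' := mul_nonneg hD.le (h.nonneg (i + 2))
      have hi1 : p.coeff (i + 1) = 0 :=
        (mul_eq_zero.mp (by linarith : B * p.coeff (i + 1) = 0)).resolve_left hB.ne'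
      have hi2 := h.zero_succ _ hi1
      rw [coeff_quadratic_mul_add_two, hi1, hi2, h.zero_succ _ hi2]
      simp
  case concave => exact h.concave_quadratic_mul hA hB.le hD.le hAD

theorem LogConcave.linear_mul (h : LogConcave p) {u v : R} (hu : 0 < u) (hv : 0 < v) :
    LogConcave ((C v * X + C u) * p) := by
  simpa using h.quadratic_mul le_rfl hv hu (by simpa using sq_nonneg v)

theorem LogConcave.coeff_linear_mul_nonneg_succ (h : LogConcave p) {u v : R} (hu : u < 0)
    (hv : 0 ≤ v) {k : ℕ} (hk : 0 ≤ ((C v * X + C u) * p).coeff k) :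
    0 ≤ ((C v * X + C u) * p).coeff (k + 1) := by
  obtain _ | k := k
  · rw [coeff_linear_mul_zero] at hk
    exact absurd hk (mul_neg_of_neg_of_pos hu h.pos).not_ge
  rw [coeff_linear_mul_succ] at hk ⊢
  rcases (h.nonneg (k + 1)).eq_or_lt with hk1 | hk1
  · rw [h.zero_succ _ hk1.symm, mul_zero, add_zero]
    exact mul_nonneg hv (h.nonneg _)
  · refine nonneg_of_mul_nonneg_left (b := p.coeff (k + 1)) ?_ hk1
    calc 0 ≤ (v * p.coeff k + u * p.coeff (k + 1)) * p.coeff (k + 2) :=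
          mul_nonneg hk (h.nonneg _)
      _ = v * (p.coeff k * p.coeff (k + 2)) + u * p.coeff (k + 1) * p.coeff (k + 2) := by ring
      _ ≤ v * p.coeff (k + 1) ^ 2 + u * p.coeff (k + 1) * p.coeff (k + 2) := by
          gcongr; exact h.concave k
      _ = (v * p.coeff (k + 1) + u * p.coeff (k + 1 + 1)) * p.coeff (k + 1) := by ring

theorem LogConcave.signVariations_linear_mul_le (h : LogConcave p) (u v : R) :
    ((C v * X + C u) * p).signVariations ≤ 1 := by
  wlog hv : 0 ≤ v generalizing u v
  · rw [← signVariations_neg, ← neg_mul, neg_add, ← neg_mul, ← C_neg, ← C_neg]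
    exact this (-u) (-v) (neg_nonneg.mpr (le_of_not_ge hv))
  rcases le_or_gt 0 u with hu | hu
  · rw [signVariations_eq_zero_of_nonneg]
    · exact zero_le_one
    rintro (_ | k)
    · rw [coeff_linear_mul_zero]; exact mul_nonneg hu (h.nonneg 0)
    · rw [coeff_linear_mul_succ]
      exact add_nonneg (mul_nonneg hv (h.nonneg k)) (mul_nonneg hu (h.nonneg _))
  · refine signVariations_le_one_of_nonneg_of_le _ fun i j hij => ?_
    induction j, hij using Nat.le_induction with
    | base => exact id
    | succ j _ ih => exact fun hi => h.coeff_linear_mul_nonneg_succ hu hv (ih hi)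

end LogConcave

section FarRoots

variable {a b : ℝ}

theorem exists_logConcave_C_mul_moebiusTransform_X_sub_C {r : ℝ} (hab : a < b)
    (hr : b - a ≤ |r - (a + b) / 2|) {q : ℝ[X]} (hq : LogConcave q) :
    ∃ c ≠ 0, LogConcave (C c * (moebiusTransform 1 (X - C r) a b * q)) := by
  rw [moebiusTransform_X_sub_C]
  rcases le_abs'.mp hr with hr | hr
  · exact ⟨1, one_ne_zero, by
      simpa using hq.linear_mul (show 0 < a - r by linarith) (show 0 < b - r by linarith)⟩
  · refine ⟨-1, by norm_num, ?_⟩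
    have := hq.linear_mul (show 0 < r - a by linarith) (show 0 < r - b by linarith)
    rwa [← mul_assoc, show C (-1) * (C (b - r) * X + C (a - r)) = C (r - b) * X + C (r - a) by
      simp only [C_sub, C_neg, C_1]; ring]

theorem mul_le_sq_of_add_le_two_mul {A B D : ℝ} (h0 : 0 ≤ A + D) (h : A + D ≤ 2 * B) :
    A * D ≤ B ^ 2 := by
  have h4 : 4 * A * D ≤ (2 * B) ^ 2 := (four_mul_le_sq_add A D).trans (by gcongr)
  linarith

/-- With `x + i y` far from the midpoint of `(a, b)`, the three coefficients of the transformed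
quadratic satisfy the log-concavity condition `A * D ≤ B ^ 2` since `A + D ≤ 2 * B`. -/
theorem logConcave_moebiusTransform_quadratic_mul {x y : ℝ} (hab : a < b)
    (hxy : (b - a) ^ 2 ≤ (x - (a + b) / 2) ^ 2 + y ^ 2) (hy : y ≠ 0) {q : ℝ[X]}
    (hq : LogConcave q) :
    LogConcave (moebiusTransform 2 (X ^ 2 - C (2 * x) * X + C (x ^ 2 + y ^ 2)) a b * q) := by
  rw [moebiusTransform_quadratic]
  have hy2 : 0 < y ^ 2 := by positivity
  have hba : 0 < (b - a) ^ 2 := pow_pos (sub_pos.mpr hab) 2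
  have hA : 0 < b ^ 2 - 2 * x * b + (x ^ 2 + y ^ 2) := by linarith [sq_nonneg (x - b)]
  have hD : 0 < a ^ 2 - 2 * x * a + (x ^ 2 + y ^ 2) := by linarith [sq_nonneg (x - a)]
  have hB : 0 < 2 * a * b - 2 * x * (a + b) + 2 * (x ^ 2 + y ^ 2) := by linarith
  exact hq.quadratic_mul hA.le hB hD
    (mul_le_sq_of_add_le_two_mul (add_pos hA hD).le (by linarith))

theorem norm_sq_eq_re_sq_add_im_sq (z : ℂ) : ‖z‖ ^ 2 = z.re ^ 2 + z.im ^ 2 := by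
  rw [← Complex.normSq_eq_norm_sq, Complex.normSq_apply]; ring

theorem aeval_ofReal_eq_zero {p : ℝ[X]} {r : ℝ} : aeval (r : ℂ) p = 0 ↔ p.eval r = 0 := by
  rw [← Complex.coe_algebraMap, aeval_algebraMap_apply, Complex.coe_algebraMap,
    Complex.ofReal_eq_zero, coe_aeval_eq_eval]

theorem exists_factor_logConcave_moebiusTransform (hab : a < b) {p : ℝ[X]}
    (hp : p.natDegree ≠ 0) (hfar : ∀ z : ℂ, aeval z p = 0 → b - a ≤ ‖z - ((a + b) / 2 : ℝ)‖) :
    ∃ f g : ℝ[X], p = f * g ∧ f.natDegree ≠ 0 ∧ ∀ q, LogConcave q →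
      ∃ c ≠ 0, LogConcave (C c * (moebiusTransform f.natDegree f a b * q)) := by
  obtain ⟨z, hz⟩ : ∃ z : ℂ, aeval z p = 0 :=
    IsAlgClosed.exists_aeval_eq_zero _ p (natDegree_pos_iff_degree_pos.mp hp.bot_lt).ne'
  have hz_far := hfar z hz
  by_cases him : z.im = 0
  · obtain ⟨r, rfl⟩ : ∃ r : ℝ, z = r := ⟨z.re, Complex.ext rfl (by simp [him])⟩
    obtain ⟨g, rfl⟩ := dvd_iff_isRoot.mpr (aeval_ofReal_eq_zero.mp hz)
    refine ⟨X - C r, g, rfl, by simp, fun q hq => ?_⟩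
    rw [natDegree_X_sub_C]
    rw [← Complex.ofReal_sub, Complex.norm_real, Real.norm_eq_abs] at hz_far
    exact exists_logConcave_C_mul_moebiusTransform_X_sub_C hab hz_far hq
  · obtain ⟨g, hg⟩ := quadratic_dvd_of_aeval_eq_zero_im_ne_zero p hz him
    have hdeg : (X ^ 2 - C (2 * z.re) * X + C (‖z‖ ^ 2)).natDegree = 2 := by compute_degree!
    refine ⟨_, g, hg, by rw [hdeg]; exact two_ne_zero, fun q hq => ⟨1, one_ne_zero, ?_⟩⟩
    rw [hdeg, C_1, one_mul, norm_sq_eq_re_sq_add_im_sq]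
    refine logConcave_moebiusTransform_quadratic_mul hab ?_ him hq
    calc (b - a) ^ 2 ≤ ‖z - ((a + b) / 2 : ℝ)‖ ^ 2 := by have := sub_pos.mpr hab; gcongr
      _ = (z.re - (a + b) / 2) ^ 2 + z.im ^ 2 := by
        rw [norm_sq_eq_re_sq_add_im_sq, Complex.sub_re, Complex.sub_im, Complex.ofReal_re,
          Complex.ofReal_im, sub_zero]

theorem exists_logConcave_C_mul_moebiusTransform (hab : a < b) {p : ℝ[X]} (hp : p ≠ 0)
    (hfar : ∀ z : ℂ, aeval z p = 0 → b - a ≤ ‖z - ((a + b) / 2 : ℝ)‖) :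
    ∃ c ≠ 0, LogConcave (C c * moebiusTransform p.natDegree p a b) := by
  induction hn : p.natDegree using Nat.strong_induction_on generalizing p with | _ n ih =>
  subst hn
  by_cases hdeg : p.natDegree = 0
  · obtain ⟨x, rfl⟩ := natDegree_eq_zero.mp hdeg
    have hx : x ≠ 0 := by simpa using hp
    exact ⟨x, hx, by
      rw [hdeg, moebiusTransform_C, ← C_mul]; exact logConcave_C (mul_self_pos.mpr hx)⟩
  obtain ⟨f, g, rfl, hf, hfc⟩ := exists_factor_logConcave_moebiusTransform hab hdeg hfar
  have hdeg_mul := natDegree_mul (left_ne_zero_of_mul hp) (right_ne_zero_of_mul hp)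
  obtain ⟨c, hc, hcg⟩ := ih g.natDegree (by omega) (right_ne_zero_of_mul hp)
    (fun z hz => hfar z (by rw [map_mul, hz, mul_zero])) rfl
  obtain ⟨d, hd, hdf⟩ := hfc _ hcg
  refine ⟨d * c, mul_ne_zero hd hc, ?_⟩
  rw [hdeg_mul, moebiusTransform_mul le_rfl le_rfl, C_mul]
  convert hdf using 1
  ring

theorem signVariations_moebiusTransform_of_far (hab : a < b) {p : ℝ[X]} (hp : p ≠ 0)
    (hfar : ∀ z : ℂ, aeval z p = 0 → b - a ≤ ‖z - ((a + b) / 2 : ℝ)‖) :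
    (moebiusTransform p.natDegree p a b).signVariations = 0 := by
  obtain ⟨c, hc, hlc⟩ := exists_logConcave_C_mul_moebiusTransform hab hp hfar
  rw [← signVariations_C_mul _ hc, signVariations_eq_zero_of_nonneg _ hlc.nonneg]

theorem signVariations_moebiusTransform_X_sub_C_mul_le (hab : a < b) (r : ℝ) {p : ℝ[X]}
    (hp : p ≠ 0) (hfar : ∀ z : ℂ, aeval z p = 0 → b - a ≤ ‖z - ((a + b) / 2 : ℝ)‖) :
    (moebiusTransform ((X - C r) * p).natDegree ((X - C r) * p) a b).signVariations ≤ 1 := by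
  obtain ⟨c, hc, hlc⟩ := exists_logConcave_C_mul_moebiusTransform hab hp hfar
  rw [natDegree_mul (X_sub_C_ne_zero r) hp, natDegree_X_sub_C,
    moebiusTransform_mul (natDegree_X_sub_C_le r) le_rfl, moebiusTransform_X_sub_C,
    ← signVariations_C_mul _ hc, mul_left_comm]
  exact hlc.signVariations_linear_mul_le _ _

/-- A unique close root is real, because its conjugate is as close. -/
theorem signVariations_moebiusTransform_le_one (hab : a < b) {p : ℝ[X]} (hp : p.Separable)
    (hclose : ∀ z w : ℂ, aeval z p = 0 → aeval w p = 0 → ‖z - ((a + b) / 2 : ℝ)‖ < b - a →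
      ‖w - ((a + b) / 2 : ℝ)‖ < b - a → z = w) :
    (moebiusTransform p.natDegree p a b).signVariations ≤ 1 := by
  by_cases hfar : ∀ z : ℂ, aeval z p = 0 → b - a ≤ ‖z - ((a + b) / 2 : ℝ)‖
  · simp [signVariations_moebiusTransform_of_far hab hp.ne_zero hfar]
  push Not at hfar
  obtain ⟨z, hz, hz_close⟩ := hfar
  have hconj : (starRingEnd ℂ) z = z := by
    refine hclose _ _ (by rw [aeval_conj, hz, map_zero]) hz ?_ hz_close
    rwa [← Complex.norm_conj, map_sub, Complex.conj_conj, Complex.conj_ofReal]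
  obtain ⟨r, rfl⟩ := Complex.conj_eq_iff_real.mp hconj
  obtain ⟨q, rfl⟩ := dvd_iff_isRoot.mpr (aeval_ofReal_eq_zero.mp hz)
  have hqr : aeval (r : ℂ) q ≠ 0 := fun h0 => by
    obtain ⟨s, rfl⟩ := dvd_iff_isRoot.mpr (aeval_ofReal_eq_zero.mp h0)
    exact not_isUnit_X_sub_C r (hp.squarefree (X - C r) ⟨s, (mul_assoc _ _ _).symm⟩)
  refine signVariations_moebiusTransform_X_sub_C_mul_le hab r (right_ne_zero_of_mul hp.ne_zero)
    fun w hw => le_of_not_gt fun hlt => hqr ?_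
  rwa [← hclose w r (by rw [map_mul, hw, mul_zero]) hz hlt hz_close]

end FarRoots

/-! ### Real root isolation -/

section RootsInInterval

variable {a b x : ℝ} {p : ℝ[X]}

theorem moebius_inverse (hx : x ∈ Set.Ioo a b) :
    0 < (x - a) / (b - x) ∧ (a + b * ((x - a) / (b - x))) / (1 + (x - a) / (b - x)) = x := by
  have hax : 0 < x - a := sub_pos.mpr hx.1
  have hbx : 0 < b - x := sub_pos.mpr hx.2
  refine ⟨by positivity, ?_⟩
  rw [div_eq_iff (by positivity)]
  field_simp
  ring

theorem eval_moebiusTransform_eq_zero_iff {n : ℕ} (hp : p.natDegree ≤ n) {z : ℝ} (hz : 0 < z) :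
    (moebiusTransform n p a b).eval z = 0 ↔ p.eval ((a + b * z) / (1 + z)) = 0 := by
  have hz1 : 1 + z ≠ 0 := by positivity
  simp [eval_moebiusTransform hp _ _ hz1, hz1]

theorem eval_moebiusTransform_inverse_eq_zero_iff {n : ℕ} (hp : p.natDegree ≤ n)
    (hx : x ∈ Set.Ioo a b) :
    (moebiusTransform n p a b).eval ((x - a) / (b - x)) = 0 ↔ p.eval x = 0 := by
  rw [eval_moebiusTransform_eq_zero_iff hp (moebius_inverse hx).1, (moebius_inverse hx).2]

theorem moebiusTransform_ne_zero {n : ℕ} (hp : p.natDegree ≤ n) (hp0 : p ≠ 0) (hab : a < b) :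
    moebiusTransform n p a b ≠ 0 := by
  refine fun h0 => hp0 (eq_zero_of_infinite_isRoot p ((Set.Ioo_infinite hab).mono fun x hx => ?_))
  exact (eval_moebiusTransform_inverse_eq_zero_iff hp hx).mp (by rw [h0, eval_zero])

theorem card_roots_le_signVariations_moebiusTransform {n : ℕ} (hp : p.natDegree ≤ n)
    (hp0 : p ≠ 0) (S : Finset ℝ) (hS : ∀ x ∈ S, x ∈ Set.Ioo a b ∧ p.eval x = 0) :
    S.card ≤ (moebiusTransform n p a b).signVariations := by
  obtain rfl | ⟨x₀, hx₀⟩ := S.eq_empty_or_nonempty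
  · simp
  have hab : a < b := (hS x₀ hx₀).1.1.trans (hS x₀ hx₀).1.2
  refine le_trans ?_ (roots_countP_pos_le_signVariations _)
  rw [Multiset.countP_eq_card_filter]
  refine le_trans ?_ (Multiset.toFinset_card_le _)
  refine Finset.card_le_card_of_injOn (fun x => (x - a) / (b - x)) (fun x hx => ?_) ?_
  · have hx := hS x hx
    rw [Finset.mem_coe, Multiset.mem_toFinset, Multiset.mem_filter,
      mem_roots (moebiusTransform_ne_zero hp hp0 hab), IsRoot,
      eval_moebiusTransform_inverse_eq_zero_iff hp hx.1]
    exact ⟨hx.2, (moebius_inverse hx.1).1⟩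
  · intro x hx y hy hxy
    have hx := moebius_inverse (hS x hx).1
    have hy := moebius_inverse (hS y hy).1
    simp only at hxy
    rw [← hx.2, ← hy.2, hxy]

theorem exists_root_of_signVariations_moebiusTransform_eq_one {n : ℕ} (hp : p.natDegree ≤ n)
    (hab : a < b) (h : (moebiusTransform n p a b).signVariations = 1) :
    ∃ x ∈ Set.Ioo a b, p.eval x = 0 := by
  obtain ⟨z, hz, hz0⟩ := exists_pos_root_of_signVariations_eq_one h
  have hz1 : 0 < 1 + z := by positivity
  refine ⟨_, ⟨?_, ?_⟩, (eval_moebiusTransform_eq_zero_iff hp hz).mp hz0⟩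
  · rw [lt_div_iff₀ hz1]; linarith [mul_lt_mul_of_pos_right hab hz]
  · rw [div_lt_iff₀ hz1]; linarith

end RootsInInterval

section Subdivide

variable {P : ℤ[X]}

theorem eval_map_algebraMap_int {A : Type*} [CommRing A] (P : ℤ[X]) (x : A) :
    (P.map (algebraMap ℤ A)).eval x = aeval x P := by
  rw [aeval_def, eval₂_eq_eval_map]

theorem aeval_ratCast_eq_zero {m : ℚ} : aeval (m : ℝ) P = 0 ↔ aeval m P = 0 := by
  rw [← eq_ratCast (algebraMap ℚ ℝ), aeval_algebraMap_apply, map_eq_zero]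

theorem descartesVar_eq (P : ℤ[X]) (a b : ℚ) :
    descartesVar P a b =
      (moebiusTransform P.natDegree (P.map (algebraMap ℤ ℝ)) (a : ℝ) b).signVariations := by
  have hmono : StrictMono (algebraMap ℚ ℝ) := Rat.cast_strictMono
  rw [descartesVar, ← signVariations_map_of_strictMono hmono, map_moebius]

theorem map_algebraMap_int_ne_zero (A : Type*) [CommRing A] [CharZero A] (hP : P ≠ 0) :
    P.map (algebraMap ℤ A) ≠ 0 :=
  (Polynomial.map_ne_zero_iff (algebraMap ℤ A).injective_int).mpr hP

theorem card_roots_le_descartesVar (hP : P ≠ 0) {a b : ℚ} (S : Finset ℝ)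
    (hS : ∀ x ∈ S, x ∈ Set.Ioo (a : ℝ) b ∧ aeval x P = 0) : S.card ≤ descartesVar P a b := by
  rw [descartesVar_eq]
  exact card_roots_le_signVariations_moebiusTransform natDegree_map_le
    (map_algebraMap_int_ne_zero ℝ hP) S fun x hx => by rw [eval_map_algebraMap_int]; exact hS x hx

theorem exists_root_of_descartesVar_eq_one {a b : ℚ} (hab : a < b)
    (h : descartesVar P a b = 1) : ∃ x ∈ Set.Ioo (a : ℝ) b, aeval x P = 0 := by
  rw [descartesVar_eq] at h
  simpa only [eval_map_algebraMap_int] using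
    exists_root_of_signVariations_moebiusTransform_eq_one natDegree_map_le (by exact_mod_cast hab) h

theorem existsUnique_root_of_descartesVar_eq_one (hP : P ≠ 0) {a b : ℚ} (hab : a < b)
    (h : descartesVar P a b = 1) : ∃! x : ℝ, x ∈ Set.Ioo (a : ℝ) b ∧ aeval x P = 0 := by
  obtain ⟨x, hx⟩ := exists_root_of_descartesVar_eq_one hab h
  refine ⟨x, hx, fun y hy => by_contra fun hne => ?_⟩
  have hcard := card_roots_le_descartesVar hP (a := a) (b := b) {y, x} fun w hw => by
    obtain rfl | rfl : w = y ∨ w = x := by simpa using hw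
    exacts [hy, hx]
  rw [Finset.card_pair hne, h] at hcard
  omega

theorem inIv_self {m : ℚ} {x : ℝ} : InIv (m, m) x ↔ x = m :=
  ⟨fun h => h.elim (fun h => absurd (h.1.trans h.2) (lt_irrefl _)) And.right,
    fun h => Or.inr ⟨h.symm, h⟩⟩

theorem inIv_iff_of_lt {a b : ℚ} (hab : a < b) {x : ℝ} :
    InIv (a, b) x ↔ x ∈ Set.Ioo (a : ℝ) b :=
  or_iff_left fun h => hab.ne (by exact_mod_cast h.1.trans h.2)

/-- The intervals in `L` are pairwise disjoint subsets of `S`, and isolate the roots of `P` in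
`S`. -/
structure IsolatesOn (P : ℤ[X]) (S : Set ℝ) (L : List (ℚ × ℚ)) : Prop where
  subset : ∀ I ∈ L, ∀ x, InIv I x → x ∈ S
  disjoint : L.Pairwise fun I J => ∀ x, InIv I x → ¬ InIv J x
  unique_root : ∀ I ∈ L, ∃! x : ℝ, InIv I x ∧ aeval x P = 0
  cover : ∀ x ∈ S, aeval x P = 0 → ∃ I ∈ L, InIv I x

theorem IsolatesOn.nil {S : Set ℝ} (h : ∀ x ∈ S, aeval x P ≠ 0) : IsolatesOn P S [] where
  subset := by simp
  disjoint := List.Pairwise.nil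
  unique_root := by simp
  cover x hx hx0 := absurd hx0 (h x hx)

theorem IsolatesOn.singleton {S : Set ℝ} {I : ℚ × ℚ} (hS : ∀ x, InIv I x ↔ x ∈ S)
    (h : ∃! x, x ∈ S ∧ aeval x P = 0) : IsolatesOn P S [I] where
  subset := by simp [hS]
  disjoint := List.pairwise_singleton _ _
  unique_root := by simpa [hS] using h
  cover x hx _ := ⟨I, List.mem_singleton_self I, (hS x).mpr hx⟩

theorem IsolatesOn.append {S T : Set ℝ} {L₁ L₂ : List (ℚ × ℚ)} (h₁ : IsolatesOn P S L₁)
    (h₂ : IsolatesOn P T L₂) (hST : Disjoint S T) : IsolatesOn P (S ∪ T) (L₁ ++ L₂) where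
  subset I hI x hx := (List.mem_append.mp hI).imp (h₁.subset I · x hx) (h₂.subset I · x hx)
  disjoint := List.pairwise_append.mpr ⟨h₁.disjoint, h₂.disjoint, fun I hI J hJ x hIx hJx =>
    Set.disjoint_left.mp hST (h₁.subset I hI x hIx) (h₂.subset J hJ x hJx)⟩
  unique_root I hI := (List.mem_append.mp hI).elim (h₁.unique_root I) (h₂.unique_root I)
  cover x hx hx0 := hx.elim
    (fun hxS => (h₁.cover x hxS hx0).imp fun _ h => ⟨List.mem_append_left _ h.1, h.2⟩)
    (fun hxT => (h₂.cover x hxT hx0).imp fun _ h => ⟨List.mem_append_right _ h.1, h.2⟩)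

theorem isolatesOn_point (P : ℤ[X]) (m : ℚ) :
    IsolatesOn P {(m : ℝ)} (if aeval m P = 0 then [(m, m)] else []) := by
  split_ifs with hm
  · exact .singleton (fun x => inIv_self) ⟨m, ⟨rfl, aeval_ratCast_eq_zero.mpr hm⟩, fun y hy => hy.1⟩
  · exact .nil fun x hx => by rwa [Set.mem_singleton_iff.mp hx, Ne, aeval_ratCast_eq_zero]

theorem IsolatesOn.bisect {a m b : ℚ} (ham : a < m) (hmb : m < b) {L₁ L₂ : List (ℚ × ℚ)}
    (h₁ : IsolatesOn P (Set.Ioo a m) L₁) (h₂ : IsolatesOn P (Set.Ioo m b) L₂) :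
    IsolatesOn P (Set.Ioo a b) (L₁ ++ (if aeval m P = 0 then [(m, m)] else []) ++ L₂) := by
  have ham' : (a : ℝ) < m := by exact_mod_cast ham
  have hmb' : (m : ℝ) < b := by exact_mod_cast hmb
  rw [← Set.Ioc_union_Ioo_eq_Ioo ham'.le hmb', ← Set.Ioo_union_right ham']
  refine (h₁.append (isolatesOn_point P m) ?_).append h₂ ?_
  · simp
  · rw [Set.Ioo_union_right ham', Set.disjoint_left]
    exact fun x hx hx' => hx.2.not_gt hx'.1

theorem Subdivide.isolatesOn (hP : P ≠ 0) {a b : ℚ} {L : List (ℚ × ℚ)} {n : ℕ}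
    (h : Subdivide P a b L n) (hab : a < b) : IsolatesOn P (Set.Ioo a b) L := by
  induction h with
  | discard a b h =>
    refine .nil fun x hx hx0 => ?_
    have hcard := card_roots_le_descartesVar hP {x} (by simpa [hx0] using hx)
    simp [h] at hcard
  | report a b h =>
    exact .singleton (fun x => inIv_iff_of_lt hab)
      (existsUnique_root_of_descartesVar_eq_one hP hab h)
  | bisect a b L₁ L₂ _ _ _ _ _ ih₁ ih₂ =>
    have ham : a < (a + b) / 2 := by linarith
    have hmb : (a + b) / 2 < b := by linarith
    exact (ih₁ ham).bisect ham hmb (ih₂ hmb)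

theorem IsolatesOn.isIsolation {S : Set ℝ} {L : List (ℚ × ℚ)} (h : IsolatesOn P S L)
    (hS : ∀ x : ℝ, aeval x P = 0 → x ∈ S) : IsIsolation P L := by
  have : Std.Symm fun I J : ℚ × ℚ => ∀ x, InIv I x → ¬ InIv J x :=
    ⟨fun I J hIJ x hJ hI => hIJ x hI hJ⟩
  refine ⟨h.disjoint.imp_of_mem fun {I J} hI _ hIJ => ?_, h.unique_root, fun x hx => ?_⟩
  · rintro rfl
    obtain ⟨x, hx, -⟩ := h.unique_root I hI
    exact hIJ x hx.1 hx.1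
  · obtain ⟨I, hI, hIx⟩ := h.cover x (hS x hx) hx
    exact ⟨I, ⟨hI, hIx⟩, fun J hJ =>
      by_contra fun hne => h.disjoint.forall hJ.1 hI hne x hJ.2 hIx⟩

theorem natAbs_coeff_le_height (P : ℤ[X]) (i : ℕ) : (P.coeff i).natAbs ≤ height P := by
  by_cases hi : P.coeff i = 0
  · simp [hi]
  · exact Finset.le_sup (f := fun i => (P.coeff i).natAbs) (mem_support_iff.mpr hi)

theorem cauchyBound_map_le (hP : P ≠ 0) : cauchyBound (P.map (algebraMap ℤ ℝ)) ≤ height P + 1 := by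
  have hlead : 1 ≤ ‖(P.map (algebraMap ℤ ℝ)).leadingCoeff‖₊ := by
    rw [leadingCoeff_map_of_injective (algebraMap ℤ ℝ).injective_int, ← NNReal.coe_le_coe,
      coe_nnnorm, eq_intCast, NNReal.coe_one, Real.norm_eq_abs]
    exact_mod_cast Int.one_le_abs (leadingCoeff_ne_zero.mpr hP)
  rw [cauchyBound]
  gcongr
  refine (div_le_self zero_le hlead).trans (Finset.sup_le fun i _ => ?_)
  rw [← NNReal.coe_le_coe, coe_nnnorm, coeff_map, eq_intCast, NNReal.coe_natCast,
    Real.norm_eq_abs, ← Int.cast_abs, Int.abs_eq_natAbs]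
  exact_mod_cast natAbs_coeff_le_height P i

theorem abs_lt_one_add_height (hP : P ≠ 0) {x : ℝ} (hx : aeval x P = 0) :
    |x| < 1 + height P := by
  have hroot : (P.map (algebraMap ℤ ℝ)).IsRoot x := by rw [IsRoot, eval_map_algebraMap_int, hx]
  have hlt := (hroot.norm_lt_cauchyBound (map_algebraMap_int_ne_zero ℝ hP)).trans_le
    (cauchyBound_map_le hP)
  rw [add_comm, ← Real.norm_eq_abs]
  exact_mod_cast hlt

theorem Isolate.isIsolation (hP : P ≠ 0) {L : List (ℚ × ℚ)} {n : ℕ} (h : Isolate P L n) :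
    IsIsolation P L := by
  cases h with
  | const h =>
    obtain ⟨c, rfl⟩ := natDegree_eq_zero.mp h
    exact (IsolatesOn.nil (S := Set.univ) (by simpa using hP)).isIsolation fun _ _ => Set.mem_univ _
  | run _ _ h hrun =>
    have hpos : (0 : ℚ) < 1 + height P := by positivity
    refine (hrun.isolatesOn hP (by linarith [hpos])).isIsolation fun x hx => ?_
    simpa using abs_lt.mp (abs_lt_one_add_height hP hx)

end Subdivide

/-! ### Amortized root separation -/

section OneNorm

variable {R : Type*} [SeminormedCommRing R]

/-- The one norm of a polynomial: the sum of the norms of its coefficients. -/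
noncomputable def oneNorm (p : R[X]) : ℝ := p.sum fun _ a => ‖a‖

theorem oneNorm_eq_sum_range {p : R[X]} {n : ℕ} (hn : p.natDegree < n) :
    oneNorm p = ∑ i ∈ Finset.range n, ‖p.coeff i‖ :=
  p.sum_over_range' (fun _ => norm_zero) n hn

theorem oneNorm_nonneg (p : R[X]) : 0 ≤ oneNorm p :=
  Finset.sum_nonneg fun _ _ => norm_nonneg _

theorem oneNorm_map_int (P : ℤ[X]) : oneNorm (P.map (algebraMap ℤ ℂ)) = norm1 P := by
  rw [oneNorm, Polynomial.sum, norm1, support_map_of_injective _ (algebraMap ℤ ℂ).injective_int,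
    Nat.cast_sum]
  refine Finset.sum_congr rfl fun i _ => ?_
  rw [coeff_map, Nat.cast_natAbs, algebraMap_int_eq, eq_intCast, Complex.norm_intCast, Int.cast_abs]

variable [NormOneClass R] {p : R[X]} {n : ℕ}

theorem norm_eval_le (hn : p.natDegree ≤ n) (x : R) :
    ‖p.eval x‖ ≤ oneNorm p * max 1 ‖x‖ ^ n := by
  rw [oneNorm_eq_sum_range (Nat.lt_succ_of_le hn), eval_eq_sum_range' (Nat.lt_succ_of_le hn),
    Finset.sum_mul]
  refine norm_sum_le_of_le _ fun i hi => (norm_mul_le _ _).trans ?_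
  gcongr
  calc ‖x ^ i‖ ≤ ‖x‖ ^ i := norm_pow_le x i
    _ ≤ max 1 ‖x‖ ^ i := by gcongr; exact le_max_right _ _
    _ ≤ max 1 ‖x‖ ^ n :=
      pow_le_pow_right₀ (le_max_left _ _) (Nat.lt_succ_iff.mp (Finset.mem_range.mp hi))

theorem oneNorm_derivative_le (hn : p.natDegree ≤ n) : oneNorm (derivative p) ≤ n * oneNorm p := by
  have hn' : (derivative p).natDegree < n + 1 :=
    ((natDegree_derivative_le p).trans (Nat.sub_le _ _)).trans_lt (Nat.lt_succ_of_le hn)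
  rw [oneNorm_eq_sum_range hn', oneNorm_eq_sum_range (show p.natDegree < n + 1 + 1 by omega),
    Finset.sum_range_succ' _ (n + 1), mul_add, Finset.mul_sum]
  refine le_add_of_le_of_nonneg (Finset.sum_le_sum fun i _ => ?_) (by positivity)
  rw [coeff_derivative, ← Nat.cast_succ]
  rcases le_or_gt (i + 1) n with hi | hi
  · refine (norm_mul_le _ _).trans ?_
    rw [mul_comm]
    gcongr
    exact (Nat.norm_cast_le _).trans (by rw [norm_one, mul_one]; exact_mod_cast hi)
  · simp [coeff_eq_zero_of_natDegree_lt (hn.trans_lt hi)]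

end OneNorm

section SmallDerivative

theorem norm_derivative_le_of_two_roots {𝕜 : Type*} [RCLike 𝕜] {p : 𝕜[X]} {α β : 𝕜} {K : ℝ}
    (hα : p.eval α = 0) (hβ : p.eval β = 0) (hne : β ≠ α)
    (hK : ∀ x ∈ Metric.closedBall α ‖β - α‖, ‖p.derivative.derivative.eval x‖ ≤ K) :
    ‖p.derivative.eval α‖ ≤ ‖β - α‖ * K := by
  set δ := ‖β - α‖
  have hδ : 0 < δ := norm_pos_iff.mpr (sub_ne_zero.mpr hne)
  have hαm : α ∈ Metric.closedBall α δ := Metric.mem_closedBall_self hδ.le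
  have hβm : β ∈ Metric.closedBall α δ := (dist_eq_norm β α).le
  have hderiv : ∀ x ∈ Metric.closedBall α δ,
      ‖p.derivative.eval x - p.derivative.eval α‖ ≤ K * δ := fun x hx => by
    have hK0 : 0 ≤ K := (norm_nonneg _).trans (hK α hαm)
    refine ((convex_closedBall α δ).norm_image_sub_le_of_norm_hasDerivWithin_le
      (fun y _ => (p.derivative.hasDerivAt y).hasDerivWithinAt) hK hαm hx).trans ?_
    gcongr
    exact (dist_eq_norm x α).symm.trans_le hx
  -- the tangent line at `α` deviates from `p` by at most `K δ ^ 2` at the root `β`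
  have htangent := (convex_closedBall α δ).norm_image_sub_le_of_norm_hasDerivWithin_le
    (f := fun x => p.eval x - p.derivative.eval α * x)
    (f' := fun x => p.derivative.eval x - p.derivative.eval α) (C := K * δ)
    (fun y _ => by
      simpa using ((p.hasDerivAt y).fun_sub
        ((hasDerivAt_id y).const_mul (p.derivative.eval α))).hasDerivWithinAt) hderiv hαm hβm
  have hval : p.eval β - p.derivative.eval α * β - (p.eval α - p.derivative.eval α * α) =
      -(p.derivative.eval α * (β - α)) := by rw [hα, hβ]; ring
  rw [hval, norm_neg, norm_mul] at htangent
  exact le_of_mul_le_mul_right (by linarith) hδ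

variable {p : ℂ[X]} {d : ℕ}

theorem norm_eval_derivative_derivative_le (hp : p.natDegree ≤ d) {α x : ℂ}
    (hx : ‖x - α‖ ≤ (d : ℝ)⁻¹) :
    ‖p.derivative.derivative.eval x‖ ≤ 3 * d ^ 2 * oneNorm p * max 1 ‖α‖ ^ d := by
  have hp' : p.derivative.natDegree ≤ d :=
    (natDegree_derivative_le p).trans ((Nat.sub_le _ _).trans hp)
  have hp'' : p.derivative.derivative.natDegree ≤ d :=
    (natDegree_derivative_le _).trans ((Nat.sub_le _ _).trans hp')
  have hnorm : oneNorm p.derivative.derivative ≤ d ^ 2 * oneNorm p := by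
    calc oneNorm p.derivative.derivative ≤ d * oneNorm p.derivative := oneNorm_derivative_le hp'
      _ ≤ d * (d * oneNorm p) := by gcongr; exact oneNorm_derivative_le hp
      _ = d ^ 2 * oneNorm p := by ring
  have hmax : max 1 ‖x‖ ≤ max 1 ‖α‖ * (1 + (d : ℝ)⁻¹) := by
    have h1 : (1 : ℝ) ≤ max 1 ‖α‖ := le_max_left _ _
    have hd : (0 : ℝ) ≤ (d : ℝ)⁻¹ := by positivity
    refine max_le (by nlinarith) ?_
    calc ‖x‖ ≤ ‖α‖ + ‖x - α‖ := norm_le_norm_add_norm_sub' _ _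
      _ ≤ max 1 ‖α‖ + max 1 ‖α‖ * (d : ℝ)⁻¹ :=
        add_le_add (le_max_right _ _) (hx.trans (le_mul_of_one_le_left hd h1))
      _ = max 1 ‖α‖ * (1 + (d : ℝ)⁻¹) := by ring
  have hp0 := oneNorm_nonneg p
  calc ‖p.derivative.derivative.eval x‖
      ≤ oneNorm p.derivative.derivative * max 1 ‖x‖ ^ d := norm_eval_le hp'' x
    _ ≤ (d ^ 2 * oneNorm p) * (max 1 ‖α‖ * (1 + (d : ℝ)⁻¹)) ^ d := by gcongr
    _ = (d ^ 2 * oneNorm p) * (max 1 ‖α‖ ^ d * (1 + (d : ℝ)⁻¹) ^ d) := by rw [mul_pow]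
    _ ≤ (d ^ 2 * oneNorm p) * (max 1 ‖α‖ ^ d * 3) := by
      gcongr
      exact Real.one_add_inv_pow_le_exp.trans Real.exp_one_lt_three.le
    _ = 3 * d ^ 2 * oneNorm p * max 1 ‖α‖ ^ d := by ring

theorem norm_eval_derivative_le (hp : p.natDegree ≤ d) (hd : 0 < d) (α : ℂ) :
    ‖p.derivative.eval α‖ ≤ (d : ℝ)⁻¹ * (3 * d ^ 2 * oneNorm p * max 1 ‖α‖ ^ d) := by
  have hp' : p.derivative.natDegree ≤ d :=
    (natDegree_derivative_le p).trans ((Nat.sub_le _ _).trans hp)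
  have hp0 := oneNorm_nonneg p
  calc ‖p.derivative.eval α‖ ≤ oneNorm p.derivative * max 1 ‖α‖ ^ d := norm_eval_le hp' α
    _ ≤ d * oneNorm p * max 1 ‖α‖ ^ d := by gcongr; exact oneNorm_derivative_le hp
    _ ≤ 3 * (d * oneNorm p * max 1 ‖α‖ ^ d) := le_mul_of_one_le_left (by positivity) (by norm_num)
    _ = (d : ℝ)⁻¹ * (3 * d ^ 2 * oneNorm p * max 1 ‖α‖ ^ d) := by field_simp

end SmallDerivative

section Separation

/-- On the finite set `S`, the function `σ` is positive, at most `1`, and bounds the distance to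
the nearest other point of `S` from below. -/
structure IsSeparation (S : Finset ℂ) (σ : ℂ → ℝ) : Prop where
  pos : ∀ α ∈ S, 0 < σ α
  le_one : ∀ α ∈ S, σ α ≤ 1
  le_dist : ∀ α ∈ S, ∀ β ∈ S, β ≠ α → σ α ≤ ‖β - α‖

variable {p : ℂ[X]}

theorem exists_separation_of_root {d : ℕ} (hd : 0 < d) (hp : p.natDegree ≤ d) {S : Finset ℂ}
    (hS : ∀ β ∈ S, p.eval β = 0) {α : ℂ} (hα : α ∈ S) :
    ∃ s : ℝ, 0 < s ∧ s ≤ 1 ∧ (∀ β ∈ S, β ≠ α → s ≤ ‖β - α‖) ∧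
      ‖p.derivative.eval α‖ ≤ s * (3 * d ^ 2 * oneNorm p * max 1 ‖α‖ ^ d) := by
  have hd1 : (d : ℝ)⁻¹ ≤ 1 := inv_le_one_of_one_le₀ (by exact_mod_cast hd)
  by_cases hclose : ∃ β ∈ S.erase α, ‖β - α‖ ≤ (d : ℝ)⁻¹
  · obtain ⟨β₀, hβ₀, hβ₀d⟩ := hclose
    obtain ⟨β, hβ, hmin⟩ := Finset.exists_min_image (S.erase α) (fun β => ‖β - α‖) ⟨β₀, hβ₀⟩
    obtain ⟨hne, hβS⟩ := Finset.mem_erase.mp hβ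
    have hβd : ‖β - α‖ ≤ (d : ℝ)⁻¹ := (hmin β₀ hβ₀).trans hβ₀d
    refine ⟨‖β - α‖, norm_pos_iff.mpr (sub_ne_zero.mpr hne), hβd.trans hd1,
      fun γ hγ hγα => hmin γ (Finset.mem_erase.mpr ⟨hγα, hγ⟩), ?_⟩
    exact norm_derivative_le_of_two_roots (hS α hα) (hS β hβS) hne fun x hx =>
      norm_eval_derivative_derivative_le hp (((dist_eq_norm x α).symm.trans_le hx).trans hβd)
  · push Not at hclose
    exact ⟨(d : ℝ)⁻¹, by positivity, hd1,
      fun γ hγ hγα => (hclose γ (Finset.mem_erase.mpr ⟨hγα, hγ⟩)).le,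
      norm_eval_derivative_le hp hd α⟩

theorem exists_isSeparation_norm_derivative_le (hd : 0 < p.natDegree) :
    ∃ σ : ℂ → ℝ, IsSeparation p.roots.toFinset σ ∧ ∀ α ∈ p.roots.toFinset, ‖p.derivative.eval α‖ ≤
      σ α * (3 * p.natDegree ^ 2 * oneNorm p * max 1 ‖α‖ ^ p.natDegree) := by
  have hroot : ∀ β ∈ p.roots.toFinset, p.eval β = 0 := fun β hβ =>
    isRoot_of_mem_roots (Multiset.mem_toFinset.mp hβ)
  choose! σ hpos hle hdist hder using fun α (hα : α ∈ p.roots.toFinset) =>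
    exists_separation_of_root hd le_rfl hroot hα
  exact ⟨σ, ⟨hpos, hle, hdist⟩, hder⟩

theorem prod_roots_toFinset {M : Type*} [CommMonoid M] (hp : p.Separable) (f : ℂ → M) :
    ∏ α ∈ p.roots.toFinset, f α = (p.roots.map f).prod := by
  rw [Finset.prod_eq_multiset_prod, Multiset.toFinset_val, (nodup_roots hp).dedup]

theorem exists_isSeparation_prod_norm_derivative_le (hp : p.Separable) (hd : 0 < p.natDegree)
    (hlead : 1 ≤ ‖p.leadingCoeff‖) :
    ∃ σ : ℂ → ℝ, IsSeparation p.roots.toFinset σ ∧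
      ‖p.leadingCoeff‖ ^ (p.natDegree - 1) * ∏ α ∈ p.roots.toFinset, ‖p.derivative.eval α‖ ≤
        (∏ α ∈ p.roots.toFinset, σ α) *
          (3 * p.natDegree ^ 2 * oneNorm p * p.mahlerMeasure) ^ p.natDegree := by
  obtain ⟨σ, hσ, hder⟩ := exists_isSeparation_norm_derivative_le hd
  refine ⟨σ, hσ, ?_⟩
  have hcard : p.roots.toFinset.card = p.natDegree := by
    rw [Multiset.toFinset_card_of_nodup (nodup_roots hp), IsAlgClosed.card_roots_eq_natDegree]
  set d := p.natDegree
  set S := p.roots.toFinset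
  calc ‖p.leadingCoeff‖ ^ (d - 1) * ∏ α ∈ S, ‖p.derivative.eval α‖
      ≤ ‖p.leadingCoeff‖ ^ d * ∏ α ∈ S, (σ α * (3 * d ^ 2 * oneNorm p * max 1 ‖α‖ ^ d)) := by
        gcongr with α hα
        exacts [Nat.sub_le _ _, hder α hα]
    _ = (∏ α ∈ S, σ α) * (3 * d ^ 2 * oneNorm p *
          (‖p.leadingCoeff‖ * ∏ α ∈ S, max 1 ‖α‖)) ^ d := by
        rw [Finset.prod_mul_distrib, Finset.prod_mul_distrib, Finset.prod_const, hcard,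
          Finset.prod_pow]
        ring
    _ = (∏ α ∈ S, σ α) * (3 * d ^ 2 * oneNorm p * p.mahlerMeasure) ^ d := by
        rw [mahlerMeasure_eq_leadingCoeff_mul_prod_roots, ← prod_roots_toFinset hp]

end Separation

section IntegerPolynomial

variable {P : ℤ[X]}

/-- The finite set of complex roots. -/
noncomputable def complexRoots (P : ℤ[X]) : Finset ℂ := (P.aroots ℂ).toFinset

theorem mem_complexRoots (hP : P ≠ 0) {z : ℂ} : z ∈ complexRoots P ↔ aeval z P = 0 := by
  rw [complexRoots, Multiset.mem_toFinset, mem_aroots, and_iff_right hP]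

theorem card_complexRoots_le (P : ℤ[X]) : (complexRoots P).card ≤ P.natDegree :=
  (Multiset.toFinset_card_le _).trans ((card_roots' _).trans natDegree_map_le)

theorem separable_map_int {K : Type*} [Field K] [CharZero K]
    (h : (P.map (algebraMap ℤ ℚ)).Separable) : (P.map (algebraMap ℤ K)).Separable := by
  have hmap := h.map (f := algebraMap ℚ K)
  rwa [Polynomial.map_map, RingHom.ext_int ((algebraMap ℚ K).comp _) (algebraMap ℤ K)] at hmap

theorem ne_zero_of_separable_map (h : (P.map (algebraMap ℤ ℚ)).Separable) : P ≠ 0 := by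
  rintro rfl
  exact h.ne_zero (Polynomial.map_zero _)

theorem one_le_norm_leadingCoeff_map (hP : P ≠ 0) :
    1 ≤ ‖(P.map (algebraMap ℤ ℂ)).leadingCoeff‖ := by
  rw [leadingCoeff_map_of_injective (algebraMap ℤ ℂ).injective_int, eq_intCast,
    Complex.norm_intCast]
  exact_mod_cast Int.one_le_abs (leadingCoeff_ne_zero.mpr hP)

/-- Up to sign the product is the resultant of `P` and its derivative, a nonzero integer. -/
theorem one_le_leadingCoeff_pow_mul_prod_derivative {p : ℂ[X]}
    (hpP : p = P.map (algebraMap ℤ ℂ)) (hp : p.Separable) :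
    1 ≤ ‖p.leadingCoeff‖ ^ (p.natDegree - 1) *
      ∏ α ∈ p.roots.toFinset, ‖p.derivative.eval α‖ := by
  set r := resultant P P.derivative p.natDegree (p.natDegree - 1)
  have hr : (r : ℂ) =
      p.leadingCoeff ^ (p.natDegree - 1) * ∏ α ∈ p.roots.toFinset, p.derivative.eval α := by
    rw [prod_roots_toFinset hp, ← resultant_eq_prod_eval p p.derivative (p.natDegree - 1)
      (natDegree_derivative_le p) (IsAlgClosed.splits p), ← eq_intCast (algebraMap ℤ ℂ),
      ← resultant_map_map, ← derivative_map, ← hpP]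
  have hr0 : r ≠ 0 := by
    have hderiv : ∀ α ∈ p.roots.toFinset, p.derivative.eval α ≠ 0 := fun α hα =>
      hp.eval₂_derivative_ne_zero (RingHom.id ℂ)
        (isRoot_of_mem_roots (Multiset.mem_toFinset.mp hα))
    exact_mod_cast hr ▸ mul_ne_zero (pow_ne_zero _ (leadingCoeff_ne_zero.mpr hp.ne_zero))
      (Finset.prod_ne_zero_iff.mpr hderiv)
  calc (1 : ℝ) ≤ ‖(r : ℂ)‖ := by
        rw [Complex.norm_intCast]; exact_mod_cast Int.one_le_abs hr0
    _ = _ := by rw [hr, norm_mul, norm_pow, norm_prod]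

theorem norm1_le (P : ℤ[X]) : norm1 P ≤ (P.natDegree + 1) * height P :=
  calc norm1 P ≤ P.support.card * height P :=
        Finset.sum_le_card_nsmul _ _ _ fun i _ => natAbs_coeff_le_height P i
    _ ≤ (P.natDegree + 1) * height P := by gcongr; exact card_supp_le_succ_natDegree P

theorem one_le_height (hP : P ≠ 0) : 1 ≤ height P :=
  (Int.natAbs_pos.mpr (leadingCoeff_ne_zero.mpr hP)).trans_le
    (natAbs_coeff_le_height P P.natDegree)

theorem exists_isSeparation_one_le_prod (hd : 0 < P.natDegree)
    (hP : (P.map (algebraMap ℤ ℚ)).Separable) :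
    ∃ σ : ℂ → ℝ, IsSeparation (complexRoots P) σ ∧
      1 ≤ (∏ α ∈ complexRoots P, σ α) *
        ((4 * P.natDegree ^ 2 * height P : ℝ) ^ 2) ^ P.natDegree := by
  set p := P.map (algebraMap ℤ ℂ) with hp
  have hdeg : p.natDegree = P.natDegree :=
    natDegree_map_eq_of_injective (algebraMap ℤ ℂ).injective_int P
  have hsep : p.Separable := separable_map_int hP
  obtain ⟨σ, hσ, hprod⟩ := exists_isSeparation_prod_norm_derivative_le hsep (hdeg ▸ hd)
    (one_le_norm_leadingCoeff_map (ne_zero_of_separable_map hP))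
  refine ⟨σ, hσ, ((one_le_leadingCoeff_pow_mul_prod_derivative hp hsep).trans hprod).trans ?_⟩
  rw [hdeg]
  set d := P.natDegree
  have hσ0 : 0 ≤ ∏ α ∈ p.roots.toFinset, σ α := Finset.prod_nonneg fun α hα => (hσ.pos α hα).le
  have hnorm : oneNorm p ≤ 2 * d * height P := by
    have h1 : (1 : ℝ) ≤ d := by exact_mod_cast hd
    calc oneNorm p = norm1 P := oneNorm_map_int P
      _ ≤ (d + 1) * height P := by exact_mod_cast norm1_le P
      _ ≤ 2 * d * height P := by gcongr; linarith
  have hmahler : p.mahlerMeasure ≤ 2 * d * height P :=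
    (mahlerMeasure_le_sum_norm_coeff p).trans hnorm
  have hm0 : 0 ≤ p.mahlerMeasure := p.mahlerMeasure_nonneg
  have hn0 := oneNorm_nonneg p
  refine mul_le_mul_of_nonneg_left (pow_le_pow_left₀ (by positivity) ?_ d) hσ0
  calc 3 * d ^ 2 * oneNorm p * p.mahlerMeasure
      ≤ 4 * d ^ 2 * (2 * d * height P) * (2 * d * height P) := by gcongr; norm_num
    _ = (4 * d ^ 2 * height P : ℝ) ^ 2 := by ring

theorem exists_isSeparation_sum_logb_le (hd : 0 < P.natDegree)
    (hP : (P.map (algebraMap ℤ ℚ)).Separable) :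
    ∃ σ : ℂ → ℝ, IsSeparation (complexRoots P) σ ∧
      ∑ α ∈ complexRoots P, Real.logb 2 (1 / σ α) ≤
        P.natDegree * (2 + 4 * Real.logb 2 P.natDegree + 2 * bitsize P) := by
  obtain ⟨σ, hσ, hprod⟩ := exists_isSeparation_one_le_prod hd hP
  refine ⟨σ, hσ, ?_⟩
  have hd0 : (0 : ℝ) < P.natDegree := by exact_mod_cast hd
  have hH0 : (0 : ℝ) < height P := by exact_mod_cast one_le_height (ne_zero_of_separable_map hP)
  have hsum : ∑ α ∈ complexRoots P, Real.logb 2 (1 / σ α) =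
      -Real.logb 2 (∏ α ∈ complexRoots P, σ α) := by
    rw [Real.logb_prod _ _ fun α hα => (hσ.pos α hα).ne', ← Finset.sum_neg_distrib]
    simp only [one_div, Real.logb_inv]
  have hlog := Real.logb_nonneg one_lt_two hprod
  have hlog4 : Real.logb 2 4 = 2 := by
    rw [show (4 : ℝ) = 2 ^ 2 by norm_num, Real.logb_pow, Real.logb_self_eq_one one_lt_two]
    norm_num
  rw [Real.logb_mul (Finset.prod_pos hσ.pos).ne' (by positivity), Real.logb_pow, Real.logb_pow,
    Real.logb_mul (by positivity) hH0.ne', Real.logb_mul four_ne_zero (pow_pos hd0 2).ne',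
    Real.logb_pow, hlog4] at hlog
  rw [hsum, bitsize]
  push_cast at hlog
  linarith

end IntegerPolynomial

/-! ### The size of the subdivision tree -/

section NearbyRoots

variable {P : ℤ[X]} {σ : ℂ → ℝ} {a b : ℚ}

theorem exists_close_roots_of_two_le_descartesVar (hP : (P.map (algebraMap ℤ ℚ)).Separable)
    (hab : a < b) (h : 2 ≤ descartesVar P a b) :
    ∃ α ∈ complexRoots P, ∃ β ∈ complexRoots P, β ≠ α ∧
      ‖α - (((a + b) / 2 : ℝ) : ℂ)‖ < b - a ∧ ‖β - (((a + b) / 2 : ℝ) : ℂ)‖ < b - a := by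
  by_contra! hfar
  have hmem : ∀ z : ℂ, aeval z (P.map (algebraMap ℤ ℝ)) = 0 → z ∈ complexRoots P := fun z hz => by
    rwa [mem_complexRoots (ne_zero_of_separable_map hP), ← aeval_map_algebraMap (A := ℝ)]
  have hle := signVariations_moebiusTransform_le_one (a := (a : ℝ)) (b := b)
    (by exact_mod_cast hab) (separable_map_int hP) fun z w hz hw hz' hw' => by_contra fun hne =>
      hw'.not_ge (hfar z (hmem z hz) w (hmem w hw) (Ne.symm hne) hz')
  rw [natDegree_map_eq_of_injective (algebraMap ℤ ℝ).injective_int, ← descartesVar_eq] at hle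
  omega

theorem exists_near_root_of_two_le_descartesVar (hP : (P.map (algebraMap ℤ ℚ)).Separable)
    (hσ : IsSeparation (complexRoots P) σ) (hab : a < b) (h : 2 ≤ descartesVar P a b) :
    ∃ α ∈ complexRoots P, σ α < 2 * (b - a) ∧ |α.re - (a + b) / 2| < b - a := by
  obtain ⟨α, hα, β, hβ, hne, hαm, hβm⟩ := exists_close_roots_of_two_le_descartesVar hP hab h
  refine ⟨α, hα, ?_, ?_⟩
  · have htri := norm_sub_le_norm_sub_add_norm_sub β (((a + b) / 2 : ℝ) : ℂ) α
    rw [norm_sub_rev (((a + b) / 2 : ℝ) : ℂ) α] at htri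
    linarith [hσ.le_dist α hα β hβ hne]
  · simpa only [Complex.sub_re, Complex.ofReal_re] using (Complex.abs_re_le_norm _).trans_lt hαm

end NearbyRoots

section Levels

/-- The number of intervals with at least two sign variations among the `2 ^ h` equal parts of
`(a, b)`: these are the intervals that the subdivision may bisect at depth `h`. -/
noncomputable def levelCount (P : ℤ[X]) (a b : ℚ) (h : ℕ) : ℕ :=
  ((Finset.range (2 ^ h)).filter fun j : ℕ =>
    2 ≤ descartesVar P (a + j * ((b - a) / 2 ^ h)) (a + (j + 1) * ((b - a) / 2 ^ h))).card

variable {P : ℤ[X]} {a b : ℚ}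

theorem levelCount_zero (P : ℤ[X]) (a b : ℚ) :
    levelCount P a b 0 = if 2 ≤ descartesVar P a b then 1 else 0 := by
  rw [levelCount, Finset.card_filter]
  simp [-Finset.sum_boole]

theorem levelCount_succ (P : ℤ[X]) (a b : ℚ) (h : ℕ) :
    levelCount P a b (h + 1) =
      levelCount P a ((a + b) / 2) h + levelCount P ((a + b) / 2) b h := by
  have hleft : ((a + b) / 2 - a) / 2 ^ h = (b - a) / 2 ^ (h + 1) := by ring
  have hright : (b - (a + b) / 2) / 2 ^ h = (b - a) / 2 ^ (h + 1) := by ring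
  have hmid (t : ℚ) : a + (2 ^ h + t) * ((b - a) / 2 ^ (h + 1)) =
      (a + b) / 2 + t * ((b - a) / 2 ^ (h + 1)) := by
    field_simp
    ring
  simp only [levelCount, Finset.card_filter, hleft, hright, pow_succ 2 h, mul_two,
    Finset.sum_range_add]
  simp only [Nat.cast_add, Nat.cast_pow, Nat.cast_ofNat, add_assoc, hmid]

theorem levelCount_halves_eq_zero {H : ℕ} (hH : ∀ h ≥ H + 1, levelCount P a b h = 0) :
    (∀ h ≥ H, levelCount P a ((a + b) / 2) h = 0) ∧
      ∀ h ≥ H, levelCount P ((a + b) / 2) b h = 0 := by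
  have hsum (h : ℕ) (hh : h ≥ H) := (levelCount_succ P a b h).symm.trans (hH (h + 1) (by omega))
  exact ⟨fun h hh => (Nat.add_eq_zero_iff.mp (hsum h hh)).1,
    fun h hh => (Nat.add_eq_zero_iff.mp (hsum h hh)).2⟩

theorem Subdivide.steps_le {L : List (ℚ × ℚ)} {n : ℕ} (hs : Subdivide P a b L n) {H : ℕ}
    (hH : ∀ h ≥ H, levelCount P a b h = 0) :
    n ≤ 1 + 2 * ∑ h ∈ Finset.range H, levelCount P a b h := by
  induction hs generalizing H with
  | discard => omega
  | report => omega
  | bisect a b _ _ n₁ n₂ h _ _ ih₁ ih₂ =>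
    have hroot : levelCount P a b 0 = 1 := by rw [levelCount_zero, if_pos h]
    obtain _ | H := H
    · exact absurd (hH 0 le_rfl) (by omega)
    · have hleft := ih₁ (levelCount_halves_eq_zero hH).1
      have hright := ih₂ (levelCount_halves_eq_zero hH).2
      simp only [Finset.sum_range_succ', hroot, levelCount_succ, Finset.sum_add_distrib]
      omega

theorem exists_subdivide {H : ℕ} (hH : ∀ h ≥ H, levelCount P a b h = 0) :
    ∃ L n, Subdivide P a b L n := by
  induction H generalizing a b with
  | zero =>
    have hroot := hH 0 le_rfl
    rw [levelCount_zero, ite_eq_right_iff] at hroot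
    obtain h | h | h : descartesVar P a b = 0 ∨ descartesVar P a b = 1 ∨
        2 ≤ descartesVar P a b := by omega
    exacts [⟨_, _, .discard a b h⟩, ⟨_, _, .report a b h⟩, absurd (hroot h) one_ne_zero]
  | succ H ih =>
    obtain h | h | h : descartesVar P a b = 0 ∨ descartesVar P a b = 1 ∨
        2 ≤ descartesVar P a b := by omega
    · exact ⟨_, _, .discard a b h⟩
    · exact ⟨_, _, .report a b h⟩
    · obtain ⟨L₁, n₁, h₁⟩ := ih (levelCount_halves_eq_zero hH).1
      obtain ⟨L₂, n₂, h₂⟩ := ih (levelCount_halves_eq_zero hH).2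
      exact ⟨_, _, .bisect a b L₁ L₂ n₁ n₂ h h₁ h₂⟩

theorem card_le_two_of_abs_sub_lt_one (s : Finset ℕ) (x : ℝ) (h : ∀ j ∈ s, |(j : ℝ) - x| < 1) :
    s.card ≤ 2 := by
  have hlt : ∀ i ∈ s, ∀ j ∈ s, i < j + 2 := fun i hi j hj => by
    have hi := (abs_lt.mp (h i hi)).2
    have hj := (abs_lt.mp (h j hj)).1
    exact_mod_cast (by linarith : (i : ℝ) < j + 2)
  by_contra! hcard
  obtain ⟨i, hi, j, hj, k, hk, hij, hik, hjk⟩ := Finset.two_lt_card.mp hcard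
  grind

variable {σ : ℂ → ℝ}

theorem levelCount_le (hP : (P.map (algebraMap ℤ ℚ)).Separable)
    (hσ : IsSeparation (complexRoots P) σ) (hab : a < b) (h : ℕ) :
    levelCount P a b h ≤
      2 * ((complexRoots P).filter fun α => σ α < 2 * (b - a) / 2 ^ h).card := by
  set w : ℚ := (b - a) / 2 ^ h with hw
  have hw0 : 0 < w := div_pos (sub_pos.mpr hab) (by positivity)
  have hwr : (0 : ℝ) < w := by exact_mod_cast hw0
  have hσw : 2 * ((b : ℝ) - a) / 2 ^ h = 2 * w := by rw [hw]; push_cast; ring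
  have hnear (j : ℕ) (hj : 2 ≤ descartesVar P (a + j * w) (a + (j + 1) * w)) :
      ∃ α ∈ complexRoots P, σ α < 2 * w ∧ |(j : ℝ) - ((α.re - a) / w - 1 / 2)| < 1 := by
    obtain ⟨α, hα, hσα, hre⟩ := exists_near_root_of_two_le_descartesVar hP hσ (by linarith) hj
    push_cast at hσα hre
    refine ⟨α, hα, by linarith, lt_of_mul_lt_mul_right ?_ hwr.le⟩
    have hscale : α.re - (a + j * w + (a + (j + 1) * w)) / 2 =
        -((j - ((α.re - a) / w - 1 / 2)) * w) := by
      field_simp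
      ring
    rw [hscale, abs_neg, abs_mul, abs_of_pos hwr] at hre
    linarith
  choose! root hmem hsep hdist using hnear
  rw [levelCount, hσw]
  refine Finset.card_le_mul_card_image_of_maps_to (f := root) (fun j hj => ?_) 2 fun α _ => ?_
  · have hj := (Finset.mem_filter.mp hj).2
    exact Finset.mem_filter.mpr ⟨hmem j hj, hsep j hj⟩
  · refine card_le_two_of_abs_sub_lt_one _ ((α.re - a) / w - 1 / 2) fun j hj => ?_
    obtain ⟨hj, hjα⟩ := Finset.mem_filter.mp hj
    exact hjα ▸ hdist j (Finset.mem_filter.mp hj).2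

theorem exists_levelCount_eq_zero (hP : (P.map (algebraMap ℤ ℚ)).Separable)
    (hσ : IsSeparation (complexRoots P) σ) (hab : a < b) :
    ∃ H, ∀ h ≥ H, levelCount P a b h = 0 := by
  have hab' : (0 : ℝ) < b - a := sub_pos.mpr (by exact_mod_cast hab)
  obtain ⟨H, hH⟩ := pow_unbounded_of_one_lt
    (∑ α ∈ complexRoots P, 2 * ((b : ℝ) - a) / σ α) one_lt_two
  refine ⟨H, fun h hh => ?_⟩
  have hnone : (complexRoots P).filter (fun α => σ α < 2 * (b - a) / 2 ^ h) = ∅ := by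
    refine Finset.filter_eq_empty_iff.mpr fun α hα => not_lt.mpr ?_
    rw [div_le_comm₀ (by positivity) (hσ.pos α hα)]
    calc 2 * ((b : ℝ) - a) / σ α ≤ ∑ α ∈ complexRoots P, 2 * ((b : ℝ) - a) / σ α :=
          Finset.single_le_sum (f := fun α => 2 * ((b : ℝ) - a) / σ α)
            (fun β hβ => div_nonneg (by linarith) (hσ.pos β hβ).le) hα
      _ ≤ 2 ^ H := hH.le
      _ ≤ 2 ^ h := pow_le_pow_right₀ one_le_two hh
  simpa [hnone] using levelCount_le hP hσ hab h

theorem card_filter_lt_div_two_pow_le {s c : ℝ} (hs : 0 < s) (hsc : s ≤ c) (H : ℕ) :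
    (((Finset.range H).filter fun h => s < c / 2 ^ h).card : ℝ) ≤ 1 + Real.logb 2 (c / s) := by
  have hsub : ((Finset.range H).filter fun h => s < c / 2 ^ h) ⊆
      Finset.range ⌈Real.logb 2 (c / s)⌉₊ := fun h hh => by
    rw [Finset.mem_range, Nat.lt_ceil, Real.lt_logb_iff_rpow_lt one_lt_two
      (div_pos (hs.trans_le hsc) hs), Real.rpow_natCast, lt_div_comm₀ (by positivity) hs]
    exact (Finset.mem_filter.mp hh).2
  have hcard := Finset.card_le_card hsub
  rw [Finset.card_range] at hcard
  calc (((Finset.range H).filter fun h => s < c / 2 ^ h).card : ℝ)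
      ≤ ⌈Real.logb 2 (c / s)⌉₊ := by exact_mod_cast hcard
    _ ≤ Real.logb 2 (c / s) + 1 :=
      (Nat.ceil_lt_add_one (Real.logb_nonneg one_lt_two ((one_le_div hs).mpr hsc))).le
    _ = 1 + Real.logb 2 (c / s) := add_comm _ _

theorem sum_levelCount_le (hP : (P.map (algebraMap ℤ ℚ)).Separable)
    (hσ : IsSeparation (complexRoots P) σ) (hab : a + 1 ≤ b) (H : ℕ) :
    ((∑ h ∈ Finset.range H, levelCount P a b h : ℕ) : ℝ) ≤
      2 * ∑ α ∈ complexRoots P, (1 + Real.logb 2 (2 * (b - a) / σ α)) := by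
  have hab' : (1 : ℝ) ≤ b - a := le_sub_iff_add_le'.mpr (by exact_mod_cast hab)
  have hcount : ∑ h ∈ Finset.range H, levelCount P a b h ≤ 2 * ∑ α ∈ complexRoots P,
      ((Finset.range H).filter fun h => σ α < 2 * ((b : ℝ) - a) / 2 ^ h).card := by
    refine (Finset.sum_le_sum fun h _ => levelCount_le hP hσ (by linarith) h).trans_eq ?_
    rw [← Finset.mul_sum]
    exact congrArg (2 * ·) (Finset.sum_card_bipartiteAbove_eq_sum_card_bipartiteBelow
      fun (h : ℕ) α => σ α < 2 * ((b : ℝ) - a) / 2 ^ h)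
  refine (Nat.cast_le.mpr hcount).trans ?_
  push_cast
  gcongr with α hα
  exact card_filter_lt_div_two_pow_le (hσ.pos α hα) (by linarith [hσ.le_one α hα]) H

end Levels

section Isolate

variable {P : ℤ[X]}

theorem exists_isolate (hP : (P.map (algebraMap ℤ ℚ)).Separable) : ∃ L n, Isolate P L n := by
  by_cases hd : P.natDegree = 0
  · exact ⟨[], 0, .const hd⟩
  obtain ⟨σ, hσ, -⟩ := exists_isSeparation_sum_logb_le (Nat.pos_of_ne_zero hd) hP
  have hpos : (0 : ℚ) < 1 + height P := by positivity
  obtain ⟨H, hH⟩ := exists_levelCount_eq_zero hP hσ (neg_lt_self hpos)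
  obtain ⟨L, n, h⟩ := exists_subdivide hH
  exact ⟨L, n, .run L n hd h⟩

theorem logb_cauchyInterval_div_le (hP : P ≠ 0) {s : ℝ} (hs : 0 < s) :
    1 + Real.logb 2 (4 * (1 + height P) / s) ≤
      3 + bitsize P + Real.logb 2 (1 / s) := by
  have hH : (1 : ℝ) ≤ height P := by exact_mod_cast one_le_height hP
  have hlog : Real.logb 2 (4 * (1 + height P) / s) ≤
      Real.logb 2 (2 ^ 3 * height P * (1 / s)) := by
    refine Real.logb_le_logb_of_le one_lt_two (by positivity) ?_
    rw [mul_one_div]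
    exact div_le_div_of_nonneg_right (by linarith) hs.le
  rw [Real.logb_mul (by positivity) (by positivity), Real.logb_mul (by positivity) (by positivity),
    Real.logb_pow, Real.logb_self_eq_one one_lt_two] at hlog
  rw [bitsize]
  push_cast at hlog
  linarith

theorem Subdivide.steps_le_of_cauchyInterval (hd : 0 < P.natDegree)
    (hP : (P.map (algebraMap ℤ ℚ)).Separable) {L : List (ℚ × ℚ)} {n : ℕ}
    (h : Subdivide P (-(1 + height P)) (1 + height P) L n) :
    (n : ℝ) ≤ 1 + 4 * (P.natDegree * (3 + bitsize P) +
      P.natDegree * (2 + 4 * Real.logb 2 P.natDegree + 2 * bitsize P)) := by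
  obtain ⟨σ, hσ, hsum⟩ := exists_isSeparation_sum_logb_le hd hP
  have hH : (1 : ℚ) ≤ 1 + height P := le_add_of_nonneg_right (Nat.cast_nonneg _)
  have hP0 := ne_zero_of_separable_map hP
  have hbit : 1 ≤ bitsize P := le_add_of_nonneg_right
    (Real.logb_nonneg one_lt_two (by exact_mod_cast one_le_height hP0))
  obtain ⟨H, hzero⟩ := exists_levelCount_eq_zero hP hσ (neg_lt_self (one_pos.trans_le hH))
  set B : ℚ := 1 + height P with hB
  have hwidth : 2 * ((B : ℝ) - (-B : ℚ)) = 4 * (1 + height P) := by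
    rw [hB]
    push_cast
    ring
  calc (n : ℝ) ≤ 1 + 2 * ((∑ h ∈ Finset.range H, levelCount P (-B) B h : ℕ) : ℝ) := by
        exact_mod_cast h.steps_le hzero
    _ ≤ 1 + 2 * (2 * ∑ α ∈ complexRoots P,
          (1 + Real.logb 2 (2 * ((B : ℝ) - (-B : ℚ)) / σ α))) := by
        gcongr
        exact sum_levelCount_le hP hσ (by linarith) H
    _ ≤ 1 + 2 * (2 * ∑ α ∈ complexRoots P, (3 + bitsize P + Real.logb 2 (1 / σ α))) := by
        gcongr 1 + 2 * (2 * ∑ α ∈ _, ?_) with α hα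
        rw [hwidth]
        exact logb_cauchyInterval_div_le hP0 (hσ.pos α hα)
    _ = 1 + 4 * ((complexRoots P).card * (3 + bitsize P) +
          ∑ α ∈ complexRoots P, Real.logb 2 (1 / σ α)) := by
        rw [Finset.sum_add_distrib, Finset.sum_const, nsmul_eq_mul]
        ring
    _ ≤ _ := by
        gcongr
        exact card_complexRoots_le P

theorem Isolate.steps_le (hP : (P.map (algebraMap ℤ ℚ)).Separable) {L : List (ℚ × ℚ)} {n : ℕ}
    (h : Isolate P L n) : (n : ℝ) ≤ 33 * solveBound P := by
  cases h with
  | const h => simp [solveBound, h]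
  | run _ _ hd hrun =>
    have hd1 : (1 : ℝ) ≤ P.natDegree := by exact_mod_cast Nat.pos_of_ne_zero hd
    have hbit : 1 ≤ bitsize P := le_add_of_nonneg_right (Real.logb_nonneg one_lt_two
      (by exact_mod_cast one_le_height (ne_zero_of_separable_map hP)))
    have hdbit : (P.natDegree : ℝ) ≤ P.natDegree * bitsize P :=
      le_mul_of_one_le_right (by linarith) hbit
    have hdlog : 0 ≤ P.natDegree * Real.logb 2 P.natDegree :=
      mul_nonneg (by linarith) (Real.logb_nonneg one_lt_two hd1)
    have hsteps := Subdivide.steps_le_of_cauchyInterval (Nat.pos_of_ne_zero hd) hP hrun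
    rw [solveBound]
    linarith

end Isolate

/-! ### A Liouville inequality -/

section IteratedResultant

theorem resultant_eq_prod_roots_eval {K L : Type*} [CommRing K] [IsDomain K] [CommRing L]
    [IsDomain L] {ι : K →+* L} (hι : Function.Injective ι) {T : K[X]} (hT : T.Splits) {g : L[X]}
    {n : ℕ} (hg : g.natDegree ≤ n) :
    resultant (T.map ι) g T.natDegree n =
      ι T.leadingCoeff ^ n * (T.roots.map fun b => g.eval (ι b)).prod := by
  have h := resultant_eq_prod_eval (T.map ι) g n hg (hT.map ι)
  rwa [natDegree_map_eq_of_injective hι, leadingCoeff_map_of_injective hι,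
    hT.roots_map_of_injective hι, Multiset.map_map] at h

theorem natDegree_eval_C_le {R : Type*} [CommSemiring R] {H : R[X][Y]} {m : ℕ}
    (hm : ∀ j, (H.coeff j).natDegree ≤ m) (b : R) : (H.eval (C b)).natDegree ≤ m := by
  rw [eval_eq_sum_range]
  refine natDegree_sum_le_of_forall_le _ _ fun j _ => ?_
  rw [← C_pow]
  exact (natDegree_mul_C_le _ _).trans (hm j)

theorem resultant_resultant_eq_prod {K : Type*} [CommRing K] [IsDomain K] {t T : K[X]}
    (ht : t.Splits) (hT : T.Splits) {H : K[X][Y]} {m n : ℕ}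
    (hm : ∀ j, (H.coeff j).natDegree ≤ m) (hn : H.natDegree ≤ n) :
    resultant t (resultant (T.map C) H T.natDegree n) t.natDegree (m * T.natDegree) =
      t.leadingCoeff ^ (m * T.natDegree) * T.leadingCoeff ^ (n * t.natDegree) *
        ((t.roots ×ˢ T.roots).map fun p => H.evalEval p.1 p.2).prod := by
  have hdeg : (resultant (T.map C) H T.natDegree n).natDegree ≤ m * T.natDegree := by
    rw [resultant_eq_prod_roots_eval C_injective hT hn, ← C_pow]
    refine (natDegree_C_mul_le _ _).trans ((natDegree_multiset_prod_le _).trans ?_)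
    rw [Multiset.map_map]
    refine (Multiset.sum_le_card_nsmul _ m fun d hd => ?_).trans ?_
    · obtain ⟨b, -, rfl⟩ := Multiset.mem_map.mp hd
      exact natDegree_eval_C_le hm b
    · rw [Multiset.card_map, smul_eq_mul, mul_comm]
      exact Nat.mul_le_mul_left m (card_roots' T)
  have hinner (a : K) : (resultant (T.map C) H T.natDegree n).eval a =
      T.leadingCoeff ^ n * (T.roots.map fun b => H.evalEval a b).prod := by
    rw [resultant_eq_prod_roots_eval C_injective hT hn, eval_mul, eval_pow, eval_C,
      eval_multiset_prod, Multiset.map_map]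
    rfl
  rw [resultant_eq_prod_eval t _ _ hdeg ht, Multiset.prod_map_product_eq_prod_prod]
  simp only [hinner, Multiset.prod_map_mul, Multiset.map_const', Multiset.prod_replicate,
    ht.natDegree_eq_card_roots]
  ring

theorem map_resultant_resultant_eq_prod {D K : Type*} [CommRing D] [CommRing K] [IsDomain K]
    {φ : D →+* K} (hφ : Function.Injective φ) {t T : D[X]} (ht : (t.map φ).Splits)
    (hT : (T.map φ).Splits) {H : D[X][Y]} {m n : ℕ} (hm : ∀ j, (H.coeff j).natDegree ≤ m)
    (hn : H.natDegree ≤ n) :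
    φ (resultant t (resultant (T.map C) H T.natDegree n) t.natDegree (m * T.natDegree)) =
      φ t.leadingCoeff ^ (m * T.natDegree) * φ T.leadingCoeff ^ (n * t.natDegree) *
        (((t.map φ).roots ×ˢ (T.map φ).roots).map fun p =>
          (H.map (mapRingHom φ)).evalEval p.1 p.2).prod := by
  have hm' (j : ℕ) : ((H.map (mapRingHom φ)).coeff j).natDegree ≤ m := by
    rw [coeff_map]
    exact natDegree_map_le.trans (hm j)
  have h := resultant_resultant_eq_prod ht hT hm' (natDegree_map_le.trans hn)
  have hTC : (T.map φ).map C = (T.map C).map (mapRingHom φ) := by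
    rw [Polynomial.map_map, Polynomial.map_map, mapRingHom_comp_C]
  rwa [natDegree_map_eq_of_injective hφ, natDegree_map_eq_of_injective hφ,
    leadingCoeff_map_of_injective hφ, leadingCoeff_map_of_injective hφ, hTC, resultant_map_map,
    coe_mapRingHom, resultant_map_map] at h

end IteratedResultant

section ValuePolynomial

theorem evalEval_map_C_sub {R K : Type*} [CommRing R] [CommRing K] [Algebra R K] (F : R[X][Y])
    (a b : K) :
    ((C (C X) - F.map (mapRingHom C)).map (mapRingHom (mapRingHom (algebraMap R K)))).evalEval
      (C a) (C b) = X - C (aevalAeval a b F) := by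
  have hcomp : ((evalEvalRingHom (C a) (C b)).comp
      (mapRingHom (mapRingHom (mapRingHom (algebraMap R K))))).comp (mapRingHom (mapRingHom C)) =
      (C : K →+* K[X]).comp (aevalAeval a b : R[X][Y] →ₐ[R] K).toRingHom := by
    ext <;> simp
  rw [Polynomial.map_sub, evalEval_sub, map_C, evalEval_C]
  congr 1
  · simp
  · exact DFunLike.congr_fun hcomp F

/-- `R` is the iterated resultant `Res_x(t, Res_y(T, z - F))`, a polynomial in `z`. -/
theorem exists_int_polynomial_of_values {F : ℤ[X][Y]} {m n : ℕ}
    (hm : ∀ j, (F.coeff j).natDegree ≤ m) (hn : F.natDegree ≤ n) (t T : ℤ[X]) :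
    ∃ R : ℤ[X], R.map (algebraMap ℤ ℂ) =
      C ((t.leadingCoeff : ℂ) ^ (m * T.natDegree) * (T.leadingCoeff : ℂ) ^ (n * t.natDegree)) *
        ((t.aroots ℂ ×ˢ T.aroots ℂ).map fun p => X - C (aevalAeval p.1 p.2 F)).prod := by
  set φ : ℤ[X] →+* ℂ[X] := mapRingHom (algebraMap ℤ ℂ)
  have hlift (P : ℤ[X]) : (P.map C).map φ = (P.map (algebraMap ℤ ℂ)).map C := by
    rw [Polynomial.map_map, Polynomial.map_map, RingHom.ext_int (φ.comp C)]
  have hsplits (P : ℤ[X]) : ((P.map C).map φ).Splits := by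
    rw [hlift]
    exact (IsAlgClosed.splits _).map C
  have hroots (P : ℤ[X]) : ((P.map C).map φ).roots = (P.aroots ℂ).map C := by
    rw [hlift, (IsAlgClosed.splits _).roots_map_of_injective C_injective, aroots]
  set H : ℤ[X][X][Y] := C (C X) - F.map (mapRingHom C)
  have hHm (j : ℕ) : (H.coeff j).natDegree ≤ m := by
    rw [coeff_sub, coeff_map]
    refine (natDegree_sub_le _ _).trans (max_le ?_ (natDegree_map_le.trans (hm j)))
    rw [coeff_C]
    split_ifs <;> simp
  have hHn : H.natDegree ≤ n :=
    (natDegree_sub_le _ _).trans (max_le (by simp) (natDegree_map_le.trans hn))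
  have h := map_resultant_resultant_eq_prod (φ := φ)
    (map_injective _ (algebraMap ℤ ℂ).injective_int) (hsplits t) (hsplits T) hHm hHn
  have hval (a b : ℂ) : (H.map (mapRingHom φ)).evalEval (C a) (C b) =
      X - C (aevalAeval a b F) := evalEval_map_C_sub F a b
  have hlead (P : ℤ[X]) : φ (P.map C).leadingCoeff = C (P.leadingCoeff : ℂ) := by
    rw [leadingCoeff_map_of_injective C_injective]
    simp [φ]
  refine ⟨_, h.trans ?_⟩
  rw [hroots, hroots, hlead, hlead, natDegree_map_eq_of_injective C_injective,
    natDegree_map_eq_of_injective C_injective, Multiset.prod_map_product_eq_prod_prod,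
    Multiset.prod_map_product_eq_prod_prod]
  simp only [Multiset.map_map, Function.comp_def, hval, C_mul, C_pow]

end ValuePolynomial

section SizeOfValues

theorem one_le_norm1 {P : ℤ[X]} (hP : P ≠ 0) : 1 ≤ norm1 P :=
  (Nat.one_le_iff_ne_zero.mpr (Int.natAbs_ne_zero.mpr (leadingCoeff_ne_zero.mpr hP))).trans
    (Finset.single_le_sum (f := fun i => (P.coeff i).natAbs) (fun _ _ => Nat.zero_le _)
      (natDegree_mem_support_of_nonzero hP))

theorem one_le_biNorm1 {F : ℤ[X][Y]} (hF : F ≠ 0) : 1 ≤ biNorm1 F :=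
  (one_le_norm1 (leadingCoeff_ne_zero.mpr hF)).trans
    (Finset.single_le_sum (f := fun j => norm1 (F.coeff j)) (fun _ _ => Nat.zero_le _)
      (natDegree_mem_support_of_nonzero hF))

theorem aevalAeval_eq_sum {R A : Type*} [CommRing R] [CommRing A] [Algebra R A] (x y : A)
    (F : R[X][Y]) : aevalAeval x y F = F.sum fun j q => aeval x q * y ^ j := by
  conv_lhs => rw [F.as_sum_support_C_mul_X_pow]
  simp only [map_sum, map_mul, map_pow, aevalAeval_C, aevalAeval_Y]
  rfl

variable {F : ℤ[X][Y]} {m n : ℕ}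

theorem norm_aevalAeval_le (hm : ∀ j, (F.coeff j).natDegree ≤ m) (hn : F.natDegree ≤ n)
    (x y : ℂ) : ‖aevalAeval x y F‖ ≤ biNorm1 F * (max 1 ‖x‖ ^ m * max 1 ‖y‖ ^ n) := by
  rw [aevalAeval_eq_sum, Polynomial.sum, biNorm1, Nat.cast_sum, Finset.sum_mul]
  refine norm_sum_le_of_le _ fun j hj => ?_
  rw [norm_mul, norm_pow, ← mul_assoc]
  gcongr
  · rw [← eval_map_algebraMap, ← oneNorm_map_int]
    exact norm_eval_le (natDegree_map_le.trans (hm j)) x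
  · calc ‖y‖ ^ j ≤ max 1 ‖y‖ ^ j := by gcongr; exact le_max_right _ _
      _ ≤ max 1 ‖y‖ ^ n :=
        pow_le_pow_right₀ (le_max_left _ _) ((le_natDegree_of_mem_supp j hj).trans hn)

theorem prod_max_one_norm_aevalAeval_le (hF : F ≠ 0) (hm : ∀ j, (F.coeff j).natDegree ≤ m)
    (hn : F.natDegree ≤ n) (s : Multiset (ℂ × ℂ)) :
    (s.map fun p => max 1 ‖aevalAeval p.1 p.2 F‖).prod ≤
      biNorm1 F ^ s.card * (s.map fun p => max 1 ‖p.1‖ ^ m * max 1 ‖p.2‖ ^ n).prod := by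
  have hN : (1 : ℝ) ≤ biNorm1 F := by exact_mod_cast one_le_biNorm1 hF
  have hU (p : ℂ × ℂ) : 1 ≤ max 1 ‖p.1‖ ^ m * max 1 ‖p.2‖ ^ n :=
    one_le_mul_of_one_le_of_one_le (one_le_pow₀ (le_max_left _ _)) (one_le_pow₀ (le_max_left _ _))
  calc (s.map fun p => max 1 ‖aevalAeval p.1 p.2 F‖).prod
      ≤ (s.map fun p => (biNorm1 F : ℝ) * (max 1 ‖p.1‖ ^ m * max 1 ‖p.2‖ ^ n)).prod :=
        Multiset.prod_map_le_prod_map₀ _ _ (fun p _ => by positivity) fun p _ =>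
          max_le (one_le_mul_of_one_le_of_one_le hN (hU p)) (norm_aevalAeval_le hm hn p.1 p.2)
    _ = _ := by rw [Multiset.prod_map_mul, Multiset.map_const', Multiset.prod_replicate]

end SizeOfValues

section Liouville

theorem max_one_norm_root_le {R : ℤ[X]} (hR : R ≠ 0) {v : ℂ} (hv : aeval v R = 0) (hv0 : v ≠ 0) :
    max 1 ‖v‖ ≤ ‖v‖ * (R.map (algebraMap ℤ ℂ)).mahlerMeasure := by
  obtain ⟨Q, hRQ, hQ⟩ := exists_eq_pow_rootMultiplicity_mul_and_not_dvd R hR 0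
  rw [dvd_iff_isRoot, IsRoot, ← coeff_zero_eq_eval_zero] at hQ
  have hQv : (Q.map (algebraMap ℤ ℂ)).IsRoot v := by
    rw [IsRoot, eval_map_algebraMap]
    rw [hRQ] at hv
    simpa [hv0] using hv
  obtain ⟨S, hS⟩ := dvd_iff_isRoot.mpr hQv
  have hQ0 : 1 ≤ ‖v‖ * S.mahlerMeasure := by
    calc (1 : ℝ) ≤ ‖(Q.map (algebraMap ℤ ℂ)).coeff 0‖ := by
          rw [coeff_map, algebraMap_int_eq, eq_intCast, Complex.norm_intCast]
          exact_mod_cast Int.one_le_abs hQ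
      _ = ‖v‖ * ‖S.coeff 0‖ := by rw [hS, mul_coeff_zero, norm_mul]; simp
      _ ≤ ‖v‖ * S.mahlerMeasure := by
        gcongr
        simpa using S.norm_coeff_le_choose_mul_mahlerMeasure 0
  have hRM : (R.map (algebraMap ℤ ℂ)).mahlerMeasure = max 1 ‖v‖ * S.mahlerMeasure := by
    have hX : (X - C (0 : ℂ)).mahlerMeasure = 1 := by
      rw [mahlerMeasure_X_sub_C, norm_zero, max_eq_left zero_le_one]
    have hXk (k : ℕ) : ((X - C (0 : ℂ)) ^ k).mahlerMeasure = 1 := by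
      induction k with
      | zero => rw [pow_zero, mahlerMeasure_one]
      | succ k ih => rw [pow_succ, mahlerMeasure_mul, ih, hX, one_mul]
    rw [← mahlerMeasure_X_sub_C, ← mahlerMeasure_mul, ← hS, hRQ, Polynomial.map_mul,
      Polynomial.map_pow, Polynomial.map_sub, map_X, map_C, map_zero, mahlerMeasure_mul, hXk,
      one_mul]
  calc max 1 ‖v‖ ≤ max 1 ‖v‖ * (‖v‖ * S.mahlerMeasure) :=
        le_mul_of_one_le_right (by positivity) hQ0
    _ = ‖v‖ * (R.map (algebraMap ℤ ℂ)).mahlerMeasure := by rw [hRM]; ring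

theorem prod_product_pow_mul_pow {ι κ M : Type*} [CommMonoid M] (s : Multiset ι)
    (u : Multiset κ) (f : ι → M) (g : κ → M) (m n : ℕ) :
    ((s ×ˢ u).map fun p => f p.1 ^ m * g p.2 ^ n).prod =
      (s.map f).prod ^ (m * u.card) * (u.map g).prod ^ (n * s.card) := by
  rw [Multiset.prod_map_product_eq_prod_prod]
  simp only [Multiset.prod_map_mul, Multiset.map_const', Multiset.prod_replicate,
    Multiset.prod_map_pow, pow_mul]

theorem card_aroots_complex (P : ℤ[X]) : (P.aroots ℂ).card = P.natDegree := by
  rw [aroots, splits_iff_card_roots.mp (IsAlgClosed.splits _),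
    natDegree_map_eq_of_injective (algebraMap ℤ ℂ).injective_int]

theorem mahlerMeasure_map_int (P : ℤ[X]) :
    (P.map (algebraMap ℤ ℂ)).mahlerMeasure =
      ‖(P.leadingCoeff : ℂ)‖ * ((P.aroots ℂ).map fun α => max 1 ‖α‖).prod := by
  rw [mahlerMeasure_eq_leadingCoeff_mul_prod_roots,
    leadingCoeff_map_of_injective (algebraMap ℤ ℂ).injective_int]
  rfl

theorem leadingCoeff_mul_prod_conjugates (t T : ℤ[X]) (m n : ℕ) :
    ‖(t.leadingCoeff : ℂ) ^ (m * T.natDegree) * (T.leadingCoeff : ℂ) ^ (n * t.natDegree)‖ *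
        ((t.aroots ℂ ×ˢ T.aroots ℂ).map fun p => max 1 ‖p.1‖ ^ m * max 1 ‖p.2‖ ^ n).prod =
      (t.map (algebraMap ℤ ℂ)).mahlerMeasure ^ (m * T.natDegree) *
        (T.map (algebraMap ℤ ℂ)).mahlerMeasure ^ (n * t.natDegree) := by
  rw [prod_product_pow_mul_pow (f := fun α => max 1 ‖α‖) (g := fun β => max 1 ‖β‖),
    card_aroots_complex, card_aroots_complex, mahlerMeasure_map_int, mahlerMeasure_map_int,
    norm_mul, norm_pow, norm_pow]
  ring

theorem exists_int_polynomial_mahlerMeasure {F : ℤ[X][Y]} {m n : ℕ}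
    (hm : ∀ j, (F.coeff j).natDegree ≤ m) (hn : F.natDegree ≤ n) {t T : ℤ[X]} (ht : t ≠ 0)
    (hT : T ≠ 0) :
    ∃ R : ℤ[X], R ≠ 0 ∧
      (∀ p ∈ t.aroots ℂ ×ˢ T.aroots ℂ, aeval (aevalAeval p.1 p.2 F) R = 0) ∧
      (R.map (algebraMap ℤ ℂ)).mahlerMeasure =
        ‖(t.leadingCoeff : ℂ) ^ (m * T.natDegree) * (T.leadingCoeff : ℂ) ^ (n * t.natDegree)‖ *
          ((t.aroots ℂ ×ˢ T.aroots ℂ).map fun p => max 1 ‖aevalAeval p.1 p.2 F‖).prod := by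
  obtain ⟨R, hR⟩ := exists_int_polynomial_of_values hm hn t T
  refine ⟨R, ?_, fun p hp => ?_, ?_⟩
  · rintro rfl
    have hlead {P : ℤ[X]} (hP : P ≠ 0) : (P.leadingCoeff : ℂ) ≠ 0 :=
      Int.cast_ne_zero.mpr (leadingCoeff_ne_zero.mpr hP)
    have hprod : ((t.aroots ℂ ×ˢ T.aroots ℂ).map fun p => X - C (aevalAeval p.1 p.2 F)).prod ≠ 0 :=
      Multiset.prod_ne_zero fun h0 => by
        obtain ⟨p, -, hp⟩ := Multiset.mem_map.mp h0
        exact X_sub_C_ne_zero _ hp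
    rw [Polynomial.map_zero] at hR
    exact mul_ne_zero (C_ne_zero.mpr (mul_ne_zero (pow_ne_zero _ (hlead ht))
      (pow_ne_zero _ (hlead hT)))) hprod hR.symm
  · rw [← eval_map_algebraMap, hR, eval_mul, eval_multiset_prod, Multiset.map_map,
      Multiset.prod_eq_zero (Multiset.mem_map.mpr ⟨p, hp, by simp⟩), mul_zero]
  · rw [hR, mahlerMeasure_mul, mahlerMeasure_const, prod_mahlerMeasure_eq_mahlerMeasure_prod,
      Multiset.map_map]
    simp only [Function.comp_def, mahlerMeasure_X_sub_C]

/-- The values of `F` at the conjugates of `(α, β)` are bounded above, and the product of the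
nonzero ones is bounded below because it is a coefficient of an integer polynomial. -/
theorem one_le_norm_aevalAeval_mul {t T : ℤ[X]} {F : ℤ[X][Y]} {m n : ℕ}
    (hm : ∀ j, (F.coeff j).natDegree ≤ m) (hn : F.natDegree ≤ n) {α β : ℂ} (hα : α ∈ t.aroots ℂ)
    (hβ : β ∈ T.aroots ℂ) (h : aevalAeval α β F ≠ 0) :
    1 ≤ ‖aevalAeval α β F‖ * biNorm1 F ^ (t.natDegree * T.natDegree - 1) *
      ((t.map (algebraMap ℤ ℂ)).mahlerMeasure ^ (m * T.natDegree) *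
        (T.map (algebraMap ℤ ℂ)).mahlerMeasure ^ (n * t.natDegree)) := by
  have hF : F ≠ 0 := by rintro rfl; exact h (map_zero _)
  have ht : t ≠ 0 := by rintro rfl; simp at hα
  have hT : T ≠ 0 := by rintro rfl; simp at hβ
  obtain ⟨R, hR, hroot, hmahler⟩ := exists_int_polynomial_mahlerMeasure hm hn ht hT
  have hconj := leadingCoeff_mul_prod_conjugates t T m n
  have hαβ : (α, β) ∈ t.aroots ℂ ×ˢ T.aroots ℂ := Multiset.mem_product.mpr ⟨hα, hβ⟩
  have hliouville := max_one_norm_root_le hR (hroot _ hαβ) h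
  obtain ⟨s, hs⟩ := Multiset.exists_cons_of_mem hαβ
  have hcard : s.card = t.natDegree * T.natDegree - 1 := by
    rw [← card_aroots_complex t, ← card_aroots_complex T, ← Multiset.card_product, hs,
      Multiset.card_cons, Nat.add_sub_cancel]
  have hothers := prod_max_one_norm_aevalAeval_le hF hm hn s
  rw [hs, Multiset.map_cons, Multiset.prod_cons] at hmahler hconj
  rw [← hconj, ← hcard]
  rw [hmahler] at hliouville
  set c := ‖(t.leadingCoeff : ℂ) ^ (m * T.natDegree) * (T.leadingCoeff : ℂ) ^ (n * t.natDegree)‖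
  set U := max 1 ‖α‖ ^ m * max 1 ‖β‖ ^ n
  have hU : 1 ≤ U :=
    one_le_mul_of_one_le_of_one_le (one_le_pow₀ (le_max_left _ _)) (one_le_pow₀ (le_max_left _ _))
  have hUs : 0 ≤ (s.map fun p => max 1 ‖p.1‖ ^ m * max 1 ‖p.2‖ ^ n).prod :=
    Multiset.prod_nonneg fun a ha => by
      obtain ⟨p, -, rfl⟩ := Multiset.mem_map.mp ha
      positivity
  set v := ‖aevalAeval α β F‖
  calc 1 ≤ v * c * (s.map fun p => max 1 ‖aevalAeval p.1 p.2 F‖).prod := by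
        refine le_of_mul_le_mul_left ?_ (zero_lt_one.trans_le (le_max_left 1 v))
        linarith [hliouville]
    _ ≤ v * c * (biNorm1 F ^ s.card *
          (U * (s.map fun p => max 1 ‖p.1‖ ^ m * max 1 ‖p.2‖ ^ n).prod)) := by
        gcongr
        refine hothers.trans ?_
        gcongr
        exact le_mul_of_one_le_left hUs hU
    _ = _ := by ring

end Liouville

/-! ### The projections -/

section CommonZeros

variable {R : Type*} [CommRing R]

/-- The common zeros of `f` and `g` in the plane over `A`: the complex ones are finite in number
for a zero-dimensional system, the real ones are the solutions to be computed. -/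
def commonZeros (A : Type*) [CommRing A] [Algebra R A] (f g : R[X][Y]) : Set (A × A) :=
  {p | aevalAeval p.1 p.2 f = 0 ∧ aevalAeval p.1 p.2 g = 0}

theorem mem_commonZeros {A : Type*} [CommRing A] [Algebra R A] {f g : R[X][Y]} {p : A × A} :
    p ∈ commonZeros A f g ↔ aevalAeval p.1 p.2 f = 0 ∧ aevalAeval p.1 p.2 g = 0 := Iff.rfl

theorem mem_commonZeros_swap {A : Type*} [CommRing A] [Algebra R A] {f g : R[X][Y]} {x y : A} :
    (y, x) ∈ commonZeros A (Bivariate.swap f) (Bivariate.swap g) ↔ (x, y) ∈ commonZeros A f g := by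
  rw [mem_commonZeros, mem_commonZeros, Bivariate.aevalAeval_swap, Bivariate.aevalAeval_swap]

theorem finite_commonZeros_swap {A : Type*} [CommRing A] [Algebra R A] {f g : R[X][Y]}
    (h : (commonZeros A f g).Finite) :
    (commonZeros A (Bivariate.swap f) (Bivariate.swap g)).Finite :=
  (h.image Prod.swap).subset fun p hp => ⟨p.swap, mem_commonZeros_swap.mp hp, p.swap_swap⟩

theorem aevalAeval_algebraMap {A B : Type*} [CommRing A] [CommRing B] [Algebra R A] [Algebra R B]
    [Algebra A B] [IsScalarTower R A B] (F : R[X][Y]) (x y : A) :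
    aevalAeval (algebraMap A B x) (algebraMap A B y) F = algebraMap A B (aevalAeval x y F) := by
  simp only [aevalAeval_eq_sum, Polynomial.sum, map_sum, map_mul, map_pow, aeval_algebraMap_apply]

theorem algebraMap_mem_commonZeros {A B : Type*} [CommRing A] [CommRing B] [Algebra R A]
    [Algebra R B] [Algebra A B] [IsScalarTower R A B] [FaithfulSMul A B] {f g : R[X][Y]} {x y : A} :
    (algebraMap A B x, algebraMap A B y) ∈ commonZeros B f g ↔ (x, y) ∈ commonZeros A f g := by
  simp only [mem_commonZeros, aevalAeval_algebraMap, FaithfulSMul.algebraMap_eq_zero_iff]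

theorem aevalAeval_eq_eval_map {A : Type*} [CommRing A] [Algebra R A] (F : R[X][Y]) (x y : A) :
    aevalAeval x y F = (F.map (aeval x : R[X] →ₐ[R] A).toRingHom).eval y := by
  rw [aevalAeval_eq_sum, eval_map, eval₂_eq_sum]
  rfl

end CommonZeros

section Resultant

variable {R K : Type*} [CommRing R] [Field K] [Algebra R K]

theorem exists_mem_commonZeros [IsAlgClosed K] {F G : R[X][Y]} (h : resultant F G = 0) {x : K}
    (hF : (F.map (aeval x : R[X] →ₐ[R] K).toRingHom).natDegree = F.natDegree)
    (hG : (G.map (aeval x : R[X] →ₐ[R] K).toRingHom).natDegree = G.natDegree) :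
    ∃ y, (x, y) ∈ commonZeros K F G := by
  set φ : R[X] →+* K := (aeval x : R[X] →ₐ[R] K).toRingHom
  have hres : resultant (F.map φ) (G.map φ) = 0 := by
    rw [hF, hG, resultant_map_map, h, map_zero]
  have hcoprime := (resultant_eq_zero_iff.mp hres).2
  rw [isCoprime_iff_aeval_ne_zero_of_isAlgClosed K K] at hcoprime
  push Not at hcoprime
  obtain ⟨y, hy⟩ := hcoprime
  refine ⟨y, mem_commonZeros.mpr ?_⟩
  rwa [aevalAeval_eq_eval_map, aevalAeval_eq_eval_map, ← coe_aeval_eq_eval]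

theorem finite_natDegree_map_aeval_ne [FaithfulSMul R K] (H : R[X][Y]) :
    {x : K | (H.map (aeval x : R[X] →ₐ[R] K).toRingHom).natDegree ≠ H.natDegree}.Finite := by
  refine (rootSet_finite H.leadingCoeff K).subset fun x hx => ?_
  have hH : H ≠ 0 := by
    rintro rfl
    exact hx (by rw [Polynomial.map_zero, natDegree_zero, natDegree_zero])
  rw [mem_rootSet', Polynomial.map_ne_zero_iff (FaithfulSMul.algebraMap_injective R K)]
  exact ⟨leadingCoeff_ne_zero.mpr hH,
    of_not_not fun h0 => hx (natDegree_map_of_leadingCoeff_ne_zero _ h0)⟩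

theorem resultant_ne_zero_of_finite [IsAlgClosed K] [FaithfulSMul R K] {F G : R[X][Y]}
    (h : (commonZeros K F G).Finite) : resultant F G ≠ 0 := by
  intro hres
  obtain ⟨x, hx⟩ := (((finite_natDegree_map_aeval_ne F).union
    (finite_natDegree_map_aeval_ne G)).union (h.image Prod.fst)).infinite_compl.nonempty
  simp only [Set.mem_compl_iff, Set.mem_union, not_or, Set.mem_ofPred_eq, not_not] at hx
  obtain ⟨y, hy⟩ := exists_mem_commonZeros hres hx.1.1 hx.1.2
  exact hx.2 ⟨_, hy, rfl⟩

theorem aeval_resultant_eq_zero [Infinite K] {F G : R[X][Y]} (h : (commonZeros K F G).Finite)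
    {x y : K} (hxy : (x, y) ∈ commonZeros K F G) : aeval x (resultant F G) = 0 := by
  obtain ⟨hF, hG⟩ := hxy
  have hdeg : F.natDegree ≠ 0 ∨ G.natDegree ≠ 0 := by
    by_contra! hd
    rw [eq_C_of_natDegree_eq_zero hd.1, eq_C_of_natDegree_eq_zero hd.2] at h
    rw [eq_C_of_natDegree_eq_zero hd.1, aevalAeval_C] at hF
    rw [eq_C_of_natDegree_eq_zero hd.2, aevalAeval_C] at hG
    refine Set.infinite_of_injective_forall_mem (Prod.mk_right_injective x) (fun z => ?_) h
    rw [mem_commonZeros, aevalAeval_C, aevalAeval_C]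
    exact ⟨hF, hG⟩
  obtain ⟨p, q, -, -, hpq⟩ := exists_mul_add_mul_eq_C_resultant F G le_rfl le_rfl hdeg
  rw [← aevalAeval_C x y, ← hpq, map_add, map_mul, map_mul, hF, hG, zero_mul, zero_mul, zero_add]

end Resultant

section NoExtraneousFactors

variable {F G : ℤ[X][Y]}

theorem aeval_noExtrRes_eq_zero (h : (commonZeros ℂ F G).Finite) {x y : ℂ}
    (hxy : (x, y) ∈ commonZeros ℂ F G) : aeval x (noExtrRes F G) = 0 := by
  classical
  have hres := aeval_resultant_eq_zero h hxy
  rw [noExtrRes]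
  split_ifs with hirr
  · exact hres
  · have hassoc := UniqueFactorizationMonoid.prod_normalizedFactors (resultant_ne_zero_of_finite h)
    obtain ⟨q, hq⟩ := hassoc.symm.dvd
    have hprod := congrArg (aeval x) hq
    rw [map_mul, hres, zero_mul, map_multiset_prod, Multiset.prod_eq_zero_iff,
      Multiset.mem_map] at hprod
    obtain ⟨p, hp, hp0⟩ := hprod
    rw [map_prod]
    refine Finset.prod_eq_zero (Finset.mem_filter.mpr ⟨Multiset.mem_toFinset.mpr hp, ?_⟩) hp0
    exact not_not.mpr ⟨x, y, hxy.1, hxy.2, hp0⟩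

theorem natDegree_ne_zero_of_aeval_eq_zero {R A : Type*} [CommRing R] [CommRing A] [Algebra R A]
    [FaithfulSMul R A] {p : R[X]} (hp : p ≠ 0) {x : A} (hx : aeval x p = 0) : p.natDegree ≠ 0 := by
  intro hd
  rw [eq_C_of_natDegree_eq_zero hd, aeval_C, FaithfulSMul.algebraMap_eq_zero_iff] at hx
  exact hp (by rw [eq_C_of_natDegree_eq_zero hd, hx, C_0])

theorem separable_map_prod_of_irreducible {s : Finset ℤ[X]} (hirr : ∀ p ∈ s, Irreducible p)
    (hdeg : ∀ p ∈ s, p.natDegree ≠ 0) (hnorm : ∀ p ∈ s, normalize p = p) :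
    ((∏ p ∈ s, p).map (algebraMap ℤ ℚ)).Separable := by
  have hprim (p) (hp : p ∈ s) : p.IsPrimitive := (hirr p hp).isPrimitive (hdeg p hp)
  have hirrQ (p) (hp : p ∈ s) : Irreducible (p.map (algebraMap ℤ ℚ)) :=
    (IsPrimitive.Int.irreducible_iff_irreducible_map_cast (hprim p hp)).mp (hirr p hp)
  rw [Polynomial.map_prod]
  refine separable_prod' (fun p hp q hq hne => ?_) fun p hp => (hirrQ p hp).separable
  refine (hirrQ p hp).coprime_iff_not_dvd.mpr fun hdvd => hne ?_
  have hdvd' : p ∣ q :=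
    (IsPrimitive.Int.dvd_iff_map_cast_dvd_map_cast _ _ (hprim p hp)).mpr hdvd
  rw [← hnorm p hp, ← hnorm q hq, normalize_eq_normalize_iff_associated]
  exact (hirr p hp).associated_of_dvd (hirr q hq) hdvd'

theorem separable_noExtrRes (F G : ℤ[X][Y]) :
    ((noExtrRes F G).map (algebraMap ℤ ℚ)).Separable := by
  classical
  rw [noExtrRes]
  split_ifs with hirr
  · exact hirr.separable
  · refine separable_map_prod_of_irreducible (fun p hp => ?_) (fun p hp => ?_) fun p hp => ?_
    all_goals obtain ⟨hp, hextr⟩ := Finset.mem_filter.mp hp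
    all_goals rw [Multiset.mem_toFinset] at hp
    · exact UniqueFactorizationMonoid.irreducible_of_normalized_factor p hp
    · obtain ⟨x, y, -, -, hx⟩ := not_not.mp hextr
      exact natDegree_ne_zero_of_aeval_eq_zero
        (UniqueFactorizationMonoid.irreducible_of_normalized_factor p hp).ne_zero hx
    · exact UniqueFactorizationMonoid.normalize_normalized_factor p hp

theorem noExtrRes_ne_zero (F G : ℤ[X][Y]) : noExtrRes F G ≠ 0 :=
  ne_zero_of_separable_map (separable_noExtrRes F G)

theorem aeval_resX_eq_zero (h : (commonZeros ℂ F G).Finite) {x y : ℝ}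
    (hxy : (x, y) ∈ commonZeros ℝ F G) : aeval x (resX F G) = 0 := by
  have hx := aeval_noExtrRes_eq_zero h (algebraMap_mem_commonZeros.mpr hxy)
  rwa [aeval_algebraMap_apply, FaithfulSMul.algebraMap_eq_zero_iff] at hx

theorem aeval_resY_eq_zero (h : (commonZeros ℂ F G).Finite) {x y : ℝ}
    (hxy : (x, y) ∈ commonZeros ℝ F G) : aeval y (resY F G) = 0 :=
  aeval_resX_eq_zero (finite_commonZeros_swap h) (mem_commonZeros_swap.mpr hxy)

end NoExtraneousFactors

section ClearingDenominators

theorem intCast_num_mul {q : ℚ} {D : ℕ} (h : q.den ∣ D) : ((q * D).num : ℚ) = q * D := by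
  obtain ⟨k, rfl⟩ := h
  rw [Nat.cast_mul, ← mul_assoc, Rat.mul_den_eq_num]
  exact_mod_cast congrArg Int.cast (Rat.num_intCast (q.num * k))

theorem commonDen_ne_zero (f : ℚ[X][Y]) : commonDen f ≠ 0 := by
  simp [commonDen, Finset.lcm_eq_zero_iff]

theorem den_dvd_commonDen (f : ℚ[X][Y]) (i j : ℕ) : ((f.coeff j).coeff i).den ∣ commonDen f := by
  by_cases hi : i ∈ (f.coeff j).support
  · have hj : j ∈ f.support := mem_support_iff.mpr fun h0 => by simp [h0] at hi
    exact (Finset.dvd_lcm (f := fun i => ((f.coeff j).coeff i).den) hi).trans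
      (Finset.dvd_lcm (f := fun j => (f.coeff j).support.lcm fun i => ((f.coeff j).coeff i).den) hj)
  · rw [notMem_support_iff.mp hi]
    exact one_dvd _

theorem map_clearDen (f : ℚ[X][Y]) :
    (clearDen f).map (mapRingHom (algebraMap ℤ ℚ)) = C (C (commonDen f : ℚ)) * f := by
  have hcoeff (i j : ℕ) : (((f.coeff j).coeff i * (commonDen f : ℚ)).num : ℚ) =
      commonDen f * (f.coeff j).coeff i := by
    rw [intCast_num_mul (den_dvd_commonDen f i j), mul_comm]
  ext j i
  rw [coeff_map, coe_mapRingHom, coeff_map, coeff_C_mul, coeff_C_mul, ← hcoeff, clearDen]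
  simp only [finsetSum_coeff, coeff_monomial, Finset.sum_ite_eq']
  split_ifs with hj
  · simp only [finsetSum_coeff, coeff_monomial, Finset.sum_ite_eq']
    split_ifs with hi
    · rfl
    · simp [notMem_support_iff.mp hi]
  · simp [notMem_support_iff.mp hj]

theorem aevalAeval_map_mapRingHom {R S A : Type*} [CommRing R] [CommRing S] [CommRing A]
    [Algebra R S] [Algebra R A] [Algebra S A] [IsScalarTower R S A] (F : R[X][Y]) (x y : A) :
    aevalAeval x y (F.map (mapRingHom (algebraMap R S))) = aevalAeval x y F := by
  have hcomp : (aeval x : S[X] →ₐ[S] A).toRingHom.comp (mapRingHom (algebraMap R S)) =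
      (aeval x : R[X] →ₐ[R] A).toRingHom := RingHom.ext fun q => aeval_map_algebraMap S x q
  rw [aevalAeval_eq_eval_map, aevalAeval_eq_eval_map, Polynomial.map_map, hcomp]

theorem commonZeros_clearDen {A : Type*} [Field A] [Algebra ℚ A] (f g : ℚ[X][Y]) :
    commonZeros A (clearDen f) (clearDen g) = commonZeros A f g := by
  have hzero (f : ℚ[X][Y]) (x y : A) : aevalAeval x y (clearDen f) = 0 ↔ aevalAeval x y f = 0 := by
    rw [← aevalAeval_map_mapRingHom (S := ℚ), map_clearDen, map_mul, aevalAeval_C, aeval_C,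
      mul_eq_zero, FaithfulSMul.algebraMap_eq_zero_iff, Nat.cast_eq_zero,
      or_iff_right (commonDen_ne_zero f)]
  ext p
  simp only [mem_commonZeros, hzero]

end ClearingDenominators

/-! ### The threshold and the matching -/

section Matching

theorem matchRow_eq {A B : Type} (test : A → B → Bool) (a : A) (bs : List B) :
    matchRow test a bs = ((bs.map (Prod.mk a)).filter fun p => test p.1 p.2, bs.length) := by
  induction bs with
  | nil => rfl
  | cons b bs ih => simp [matchRow, ih, List.filter_cons]

theorem matchAll_eq {A B : Type} (test : A → B → Bool) (as : List A) (bs : List B) :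
    matchAll test as bs =
      ((as ×ˢ bs).filter fun p => test p.1 p.2, as.length * bs.length) := by
  induction as with
  | nil => simp [matchAll]
  | cons a as ih =>
    simp only [matchAll, matchRow_eq, ih, List.product_cons, List.filter_append, List.length_cons,
      add_one_mul, add_comm]

end Matching

namespace IsIsolation

variable {P : ℤ[X]} {L : List (ℚ × ℚ)} (h : IsIsolation P L)
include h

theorem isoRoot_spec {I : ℚ × ℚ} (hI : I ∈ L) : InIv I (isoRoot P I) ∧ aeval (isoRoot P I) P = 0 :=
  Classical.epsilon_spec (h.2.1 I hI).exists

theorem eq_isoRoot {I : ℚ × ℚ} (hI : I ∈ L) {x : ℝ} (hx : InIv I x) (hx0 : aeval x P = 0) :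
    x = isoRoot P I :=
  (h.2.1 I hI).unique ⟨hx, hx0⟩ (h.isoRoot_spec hI)

theorem length_le (hP : P ≠ 0) : L.length ≤ (P.rootSet ℝ).ncard := by
  rw [← List.toFinset_card_of_nodup h.1, ← Set.ncard_coe_finset]
  refine Set.ncard_le_ncard_of_injOn (isoRoot P) (fun I hI => ?_) (fun I hI J hJ e => ?_)
    (rootSet_finite P ℝ)
  · exact mem_rootSet.mpr ⟨hP, (h.isoRoot_spec (List.mem_toFinset.mp hI)).2⟩
  · have hI' := List.mem_toFinset.mp hI
    have hJ' := List.mem_toFinset.mp hJ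
    have hrootI := h.isoRoot_spec hI'
    exact (h.2.2 _ hrootI.2).unique ⟨hI', hrootI.1⟩ ⟨hJ', e ▸ (h.isoRoot_spec hJ').1⟩

end IsIsolation

section Threshold

theorem coeff_coeff_swap {R : Type*} [CommSemiring R] (F : R[X][Y]) (i j : ℕ) :
    ((Bivariate.swap F).coeff i).coeff j = (F.coeff j).coeff i := by
  induction F using Polynomial.induction_on' with
  | add p q hp hq => simp only [map_add, coeff_add, hp, hq]
  | monomial n q =>
    induction q using Polynomial.induction_on' with
    | add p q hp hq => simp only [map_add, coeff_add, hp, hq]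
    | monomial m r =>
      rw [Bivariate.swap_monomial_monomial]
      simp only [coeff_monomial]
      split_ifs <;> simp_all [coeff_monomial]

theorem natDegree_coeff_le_natDegree_swap {R : Type*} [CommSemiring R] (F : R[X][Y]) (j : ℕ) :
    (F.coeff j).natDegree ≤ (Bivariate.swap F).natDegree := by
  refine natDegree_le_iff_coeff_eq_zero.mpr fun i hi => ?_
  rw [← coeff_coeff_swap, coeff_eq_zero_of_natDegree_lt hi, coeff_zero]

variable {F G : ℤ[X][Y]} {c : ℝ}

theorem one_le_normN (h : (commonZeros ℂ F G).Finite) : 1 ≤ normN F G := by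
  by_cases hF : F = 0
  · by_cases hG : G = 0
    · subst hF hG
      exact (Set.infinite_univ (h.subset fun p _ => ⟨map_zero _, map_zero _⟩)).elim
    · exact (one_le_biNorm1 hG).trans (le_max_right _ _)
  · exact (one_le_biNorm1 hF).trans (le_max_left _ _)

theorem one_le_normM (F G : ℤ[X][Y]) : 1 ≤ normM F G :=
  (one_le_norm1 (noExtrRes_ne_zero F G)).trans (le_max_left _ _)

theorem eps_pos (h : (commonZeros ℂ F G).Finite) (c : ℝ) : 0 < eps F G c :=
  mul_pos (zpow_pos (Nat.cast_pos.mpr (one_le_normN h)) _)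
    (Real.rpow_pos_of_pos (Nat.cast_pos.mpr (one_le_normM F G)) _)

theorem eps_mul_le_one (h : (commonZeros ℂ F G).Finite) (hc : Admissible F G c)
    (hX : (resX F G).natDegree ≠ 0) (hY : (resY F G).natDegree ≠ 0) :
    eps F G c * ((normN F G : ℝ) ^ (paramS F G - 1) *
      ((normM F G : ℝ) ^ (degX F G * (resY F G).natDegree) *
        (normM F G : ℝ) ^ (degY F G * (resX F G).natDegree))) ≤ 1 := by
  have hN : (0 : ℝ) < normN F G := Nat.cast_pos.mpr (one_le_normN h)
  have hM : (1 : ℝ) ≤ normM F G := Nat.one_le_cast.mpr (one_le_normM F G)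
  have hs : ((paramS F G - 1 : ℕ) : ℤ) = -(1 - paramS F G) := by
    have hs0 : paramS F G ≠ 0 := mul_ne_zero hX hY
    lia
  have hexp : ((degX F G * (resY F G).natDegree + degY F G * (resX F G).natDegree : ℕ) : ℝ) ≤
      c * paramS F G := by
    have hcs := mul_le_mul_of_nonneg_right hc (paramS F G).cast_nonneg
    refine le_of_eq_of_le ?_ hcs
    rw [paramS]
    push_cast
    field_simp
  have hMexp : (normM F G : ℝ) ^ (degX F G * (resY F G).natDegree + degY F G * (resX F G).natDegree)
      ≤ (normM F G : ℝ) ^ (c * paramS F G) := by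
    rw [← Real.rpow_natCast]
    exact Real.rpow_le_rpow_of_exponent_le hM hexp
  rw [← pow_add, eps, Real.rpow_neg (by positivity), ← zpow_natCast, hs, zpow_neg,
    mul_mul_mul_comm, mul_inv_cancel₀ (zpow_pos hN _).ne', one_mul]
  exact (mul_le_mul_of_nonneg_left hMexp (by positivity)).trans_eq
    (inv_mul_cancel₀ (Real.rpow_pos_of_pos (by linarith [hM]) _).ne')

theorem eps_le_abs_aevalAeval (h : (commonZeros ℂ F G).Finite) (hc : Admissible F G c)
    {H : ℤ[X][Y]} (hHN : biNorm1 H ≤ normN F G)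
    (hHx : (Bivariate.swap H).natDegree ≤ degX F G) (hHy : H.natDegree ≤ degY F G) {x y : ℝ}
    (hx : aeval x (resX F G) = 0) (hy : aeval y (resY F G) = 0) (hH : aevalAeval x y H ≠ 0) :
    eps F G c ≤ |aevalAeval x y H| := by
  have hX0 : resX F G ≠ 0 := noExtrRes_ne_zero _ _
  have hY0 : resY F G ≠ 0 := noExtrRes_ne_zero _ _
  have hroot {P : ℤ[X]} (hP : P ≠ 0) {z : ℝ} (hz : aeval z P = 0) :
      algebraMap ℝ ℂ z ∈ P.aroots ℂ := by
    rw [mem_aroots, aeval_algebraMap_apply, hz, map_zero]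
    exact ⟨hP, rfl⟩
  have hmahler (P : ℤ[X]) (hP : norm1 P ≤ normM F G) :
      (P.map (algebraMap ℤ ℂ)).mahlerMeasure ≤ normM F G :=
    ((mahlerMeasure_le_sum_norm_coeff _).trans_eq (oneNorm_map_int P)).trans (Nat.cast_le.mpr hP)
  have hliouville := one_le_norm_aevalAeval_mul
    (fun j => (natDegree_coeff_le_natDegree_swap H j).trans hHx) hHy (hroot hX0 hx) (hroot hY0 hy)
    (by rwa [aevalAeval_algebraMap, Ne, FaithfulSMul.algebraMap_eq_zero_iff])
  rw [aevalAeval_algebraMap, norm_algebraMap', Real.norm_eq_abs] at hliouville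
  refine le_of_mul_le_mul_right ((eps_mul_le_one h hc (natDegree_ne_zero_of_aeval_eq_zero hX0 hx)
    (natDegree_ne_zero_of_aeval_eq_zero hY0 hy)).trans (hliouville.trans ?_)) ?_
  · rw [mul_assoc]
    gcongr
    · exact mul_nonneg (pow_nonneg (mahlerMeasure_nonneg _) _)
        (pow_nonneg (mahlerMeasure_nonneg _) _)
    · exact pow_le_pow_left₀ (Nat.cast_nonneg _) (Nat.cast_le.mpr hHN) _
    · exact pow_nonneg (mahlerMeasure_nonneg _) _
    · exact mahlerMeasure_nonneg _
    · exact hmahler _ (le_max_left _ _)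
    · exact mahlerMeasure_nonneg _
    · exact hmahler _ (le_max_right _ _)
  · have hN : (0 : ℝ) < normN F G := Nat.cast_pos.mpr (one_le_normN h)
    have hM : (0 : ℝ) < normM F G := Nat.cast_pos.mpr (one_le_normM F G)
    positivity

theorem sigmaAbs_lt_eps_iff (h : (commonZeros ℂ F G).Finite) (hc : Admissible F G c) {x y : ℝ}
    (hx : aeval x (resX F G) = 0) (hy : aeval y (resY F G) = 0) :
    sigmaAbs F G x y < eps F G c ↔ (x, y) ∈ commonZeros ℝ F G := by
  have hF := eps_le_abs_aevalAeval h hc (le_max_left _ _) (le_max_left _ _) (le_max_left _ _) hx hy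
  have hG := eps_le_abs_aevalAeval h hc (le_max_right _ _) (le_max_right _ _) (le_max_right _ _)
    hx hy
  rw [mem_commonZeros, sigmaAbs]
  have hpos := eps_pos h c
  generalize aevalAeval x y F = a at *
  generalize aevalAeval x y G = b at *
  by_cases ha : a = 0 <;> by_cases hb : b = 0 <;> simp_all

end Threshold

/-! ### Correctness -/

section Correctness

theorem IsIsolation.existsUnique_box {P Q : ℤ[X]} {L L' : List (ℚ × ℚ)} (hL : IsIsolation P L)
    (hL' : IsIsolation Q L') {x y : ℝ} (hx : aeval x P = 0) (hy : aeval y Q = 0) :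
    ∃! B, B ∈ L ×ˢ L' ∧ InIv B.1 x ∧ InIv B.2 y := by
  obtain ⟨I, ⟨hI, hxI⟩, hIunique⟩ := hL.2.2 x hx
  obtain ⟨J, ⟨hJ, hyJ⟩, hJunique⟩ := hL'.2.2 y hy
  refine ⟨(I, J), ⟨List.mem_product.mpr ⟨hI, hJ⟩, hxI, hyJ⟩, fun B ⟨hB, hxB, hyB⟩ => ?_⟩
  have hB' := List.mem_product.mp hB
  exact Prod.ext (hIunique _ ⟨hB'.1, hxB⟩) (hJunique _ ⟨hB'.2, hyB⟩)

namespace RunInt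

variable {F G : ℤ[X][Y]} {c : ℝ} {r : Result} (hr : RunInt F G c r)
include hr

theorem isIsolation_resX : IsIsolation (resX F G) r.intervalsX :=
  hr.1.isIsolation (noExtrRes_ne_zero _ _)

theorem isIsolation_resY : IsIsolation (resY F G) r.intervalsY :=
  hr.2.1.isIsolation (noExtrRes_ne_zero _ _)

theorem boxes_eq :
    r.boxes = (r.intervalsX ×ˢ r.intervalsY).filter fun B => pairTest F G c B.1 B.2 :=
  (Prod.mk.inj (hr.2.2.trans (matchAll_eq _ _ _))).1

theorem matchSteps_le :
    r.matchSteps ≤ ((resX F G).rootSet ℝ).ncard * ((resY F G).rootSet ℝ).ncard :=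
  (Prod.mk.inj (hr.2.2.trans (matchAll_eq _ _ _))).2.trans_le
    (Nat.mul_le_mul (hr.isIsolation_resX.length_le (noExtrRes_ne_zero _ _))
      (hr.isIsolation_resY.length_le (noExtrRes_ne_zero _ _)))

variable (h : (commonZeros ℂ F G).Finite)
include h

theorem eq_isoRoot_of_mem_box {B : (ℚ × ℚ) × (ℚ × ℚ)}
    (hB : B ∈ r.intervalsX ×ˢ r.intervalsY) {p : ℝ × ℝ} (hp : p ∈ commonZeros ℝ F G)
    (hpB : InIv B.1 p.1 ∧ InIv B.2 p.2) :
    p = (isoRoot (resX F G) B.1, isoRoot (resY F G) B.2) := by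
  obtain ⟨hI, hJ⟩ := List.mem_product.mp hB
  exact Prod.ext (hr.isIsolation_resX.eq_isoRoot hI hpB.1 (aeval_resX_eq_zero h hp))
    (hr.isIsolation_resY.eq_isoRoot hJ hpB.2 (aeval_resY_eq_zero h hp))

variable (hc : Admissible F G c)
include hc

theorem mem_boxes_iff {B : (ℚ × ℚ) × (ℚ × ℚ)} :
    B ∈ r.boxes ↔ B ∈ r.intervalsX ×ˢ r.intervalsY ∧
      (isoRoot (resX F G) B.1, isoRoot (resY F G) B.2) ∈ commonZeros ℝ F G := by
  rw [hr.boxes_eq, List.mem_filter]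
  refine and_congr_right fun hB => ?_
  obtain ⟨hI, hJ⟩ := List.mem_product.mp hB
  rw [pairTest, decide_eq_true_iff]
  exact sigmaAbs_lt_eps_iff h hc (hr.isIsolation_resX.isoRoot_spec hI).2
    (hr.isIsolation_resY.isoRoot_spec hJ).2

theorem existsUnique_mem_box {B : (ℚ × ℚ) × (ℚ × ℚ)} (hB : B ∈ r.boxes) :
    ∃! p : ℝ × ℝ, (InIv B.1 p.1 ∧ InIv B.2 p.2) ∧ p ∈ commonZeros ℝ F G := by
  obtain ⟨hIJ, hzero⟩ := (hr.mem_boxes_iff h hc).mp hB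
  obtain ⟨hI, hJ⟩ := List.mem_product.mp hIJ
  exact ⟨_, ⟨⟨(hr.isIsolation_resX.isoRoot_spec hI).1, (hr.isIsolation_resY.isoRoot_spec hJ).1⟩,
    hzero⟩, fun p ⟨hpB, hp⟩ => hr.eq_isoRoot_of_mem_box h hIJ hp hpB⟩

theorem existsUnique_box {p : ℝ × ℝ} (hp : p ∈ commonZeros ℝ F G) :
    ∃! B, B ∈ r.boxes ∧ InIv B.1 p.1 ∧ InIv B.2 p.2 := by
  refine (existsUnique_congr fun B => and_congr_left fun hpB => ?_).mpr
    (hr.isIsolation_resX.existsUnique_box hr.isIsolation_resY (aeval_resX_eq_zero h hp)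
      (aeval_resY_eq_zero h hp))
  rw [hr.mem_boxes_iff h hc, and_iff_left_iff_imp]
  exact fun hB => hr.eq_isoRoot_of_mem_box h hB hp hpB ▸ hp

theorem solutionSet_eq : solutionSet F G r = commonZeros ℝ F G := by
  ext p
  constructor
  · rintro ⟨B, hB, rfl⟩
    exact ((hr.mem_boxes_iff h hc).mp hB).2
  · intro hp
    obtain ⟨B, ⟨hB, hpB⟩, -⟩ := hr.existsUnique_box h hc hp
    exact ⟨B, hB, hr.eq_isoRoot_of_mem_box h ((hr.mem_boxes_iff h hc).mp hB).1 hp hpB⟩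

end RunInt

theorem realSolutions_eq (f g : ℚ[X][Y]) :
    realSolutions f g = commonZeros ℝ (clearDen f) (clearDen g) :=
  (commonZeros_clearDen f g).symm

theorem ZeroDimensional.finite_commonZeros_clearDen {f g : ℚ[X][Y]} (h : ZeroDimensional f g) :
    (commonZeros ℂ (clearDen f) (clearDen g)).Finite := by
  rwa [commonZeros_clearDen]

theorem Run.isolatesSolutions {f g : ℚ[X][Y]} {c : ℝ} {r : Result} (hr : Run f g c r)
    (h : ZeroDimensional f g) (hc : Admissible (clearDen f) (clearDen g) c) :
    IsolatesSolutions f g r.boxes := by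
  have hfin := h.finite_commonZeros_clearDen
  rw [IsolatesSolutions, realSolutions_eq]
  refine ⟨?_, fun B => RunInt.existsUnique_mem_box hr hfin hc,
    fun p => RunInt.existsUnique_box hr hfin hc⟩
  rw [RunInt.boxes_eq hr]
  exact ((RunInt.isIsolation_resX hr).1.product (RunInt.isIsolation_resY hr).1).filter _

theorem exists_run (f g : ℚ[X][Y]) (c : ℝ) : ∃ r, Run f g c r := by
  obtain ⟨L, n, hL⟩ := exists_isolate (separable_noExtrRes (clearDen f) (clearDen g))
  obtain ⟨L', n', hL'⟩ := exists_isolate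
    (separable_noExtrRes (Bivariate.swap (clearDen f)) (Bivariate.swap (clearDen g)))
  exact ⟨⟨L, n, L', n', _, _⟩, hL, hL', (matchAll_eq _ _ _).symm⟩

end Correctness

end ZMM

theorem theorem3p1 :
    ∃ K : ℝ, 0 < K ∧
      ∀ f g : Polynomial (Polynomial ℚ), ZMM.ZeroDimensional f g →
      ∀ F G : Polynomial (Polynomial ℤ), F = ZMM.clearDen f → G = ZMM.clearDen g →
      ∀ t T : Polynomial ℤ, t = ZMM.resX F G → T = ZMM.resY F G →
      ∀ c : ℝ, ZMM.Admissible F G c →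
        -- the algorithm terminates
        (∃ r : ZMM.Result, ZMM.Run f g c r) ∧
        ∀ r : ZMM.Result, ZMM.Run f g c r →
          -- correctness
          (ZMM.IsIsolation t r.intervalsX ∧ ZMM.IsIsolation T r.intervalsY ∧
            ZMM.solutionSet F G r = ZMM.realSolutions f g ∧
            ZMM.IsolatesSolutions f g r.boxes) ∧
          -- real solving of the two univariate polynomials
          ((r.stepsX : ℝ) ≤ K * ZMM.solveBound t ∧ (r.stepsY : ℝ) ≤ K * ZMM.solveBound T) ∧
          -- matching, with `u` and `v` the numbers of real roots of `t` and `T`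
          (r.matchSteps : ℝ) ≤
            K * ((t.rootSet ℝ).ncard * (T.rootSet ℝ).ncard) := by
  refine ⟨33, by norm_num, ?_⟩
  rintro f g hfg F G rfl rfl t T rfl rfl c hc
  refine ⟨ZMM.exists_run f g c, fun r hr => ⟨⟨ZMM.RunInt.isIsolation_resX hr,
    ZMM.RunInt.isIsolation_resY hr, ?_, hr.isolatesSolutions hfg hc⟩, ⟨?_, ?_⟩, ?_⟩⟩
  · rw [ZMM.realSolutions_eq]
    exact ZMM.RunInt.solutionSet_eq hr hfg.finite_commonZeros_clearDen hc
  · exact hr.1.steps_le (ZMM.separable_noExtrRes _ _)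
  · exact hr.2.1.steps_le (ZMM.separable_noExtrRes _ _)
  · refine (Nat.cast_le.mpr (ZMM.RunInt.matchSteps_le hr)).trans ?_
    rw [Nat.cast_mul]
    exact le_mul_of_one_le_left (by positivity) (by norm_num)
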